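/- **Setting.** All objects are smooth. Let $(\bar M,g,J)$ be a Kaehler manifold: a Riemannian manifold with a tensor field $J$ of type $(1,1)$ such that $J^2=-I$, $g(JX,JY)=g(X,Y)$ and $\bar\nabla J=0$, where $\bar\nabla$ is the Levi-Civita connection of $g$. Let $M$ be a Riemannian manifold isometrically immersed in $\bar M$, with induced metric also denoted by $g$. For vector fields $X,Y$ on $M$ and a normal vector field $N$, the second fundamental form $h(X,Y)$ is the normal component of $\bar\nabla_XY$, and the shape operator $A_N X$ is minus the tangential component of $\bar\nabla_XN$. For $X$ tangent to $M$ write $JX=TX+FX$ with $TX$ tangent and $FX$ normal to $M$. $M$ is a *pointwise semi-slant submanifold* if $TM=D^T\oplus D^\theta$ is an orthogonal direct sum of two distributions, of dimensions $m_1$ and $m_2$, such that $JD^T=D^T$ and $D^\theta$ is pointwise slant with slant function $\theta$, i.e. at each $p\in M$ the angle in $[0,\pi/2]$ between $JX$ and $D^\theta_p$ equals $\theta(p)$ for every nonzero $X\in D^\theta_p$. It is *proper* if $m_1\neq 0$ and $\theta$ is not constant. A distribution $D$ is *integrable* if $[X,Y]\in\Gamma(D)$ for all $X,Y\in\Gamma(D)$.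 **Theorem 3.3.** Let $M$ be a proper pointwise semi-slant submanifold of a Kaehler manifold $\bar M$, and suppose that the set $\{p\in M:\sin\theta(p)=0\}$ of complex points of $D^\theta$ has empty interior. (i) The distribution $D^T$ is integrable if and only if $$g(h(X,JY),FV)=g(h(JX,Y),FV)\qquad\text{for all } X,Y\in\Gamma(D^T),\ V\in\Gamma(D^\theta).$$ (ii) The distribution $D^\theta$ is integrable if and only if $$g(A_{FTW}V-A_{FTV}W,\,X)=g(A_{FW}V-A_{FV}W,\,JX)\qquad\text{for all } V,W\in\Gamma(D^\theta),\ X\in\Gamma(D^T).$$ -/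

import Mathlib

open Bundle Manifold
open scoped ContDiff

noncomputable section

/-- Tangent spaces of finite-dimensional manifolds are finite-dimensional. -/
instance tangentSpace_finiteDimensional
    {E : Type*} [NormedAddCommGroup E] [NormedSpace ℝ E] [FiniteDimensional ℝ E]
    {H : Type*} [TopologicalSpace H] (I : ModelWithCorners ℝ E H)
    {M : Type*} [TopologicalSpace M] [ChartedSpace H M] (x : M) :
    FiniteDimensional ℝ (TangentSpace I x) :=
  inferInstanceAs (FiniteDimensional ℝ E)

namespace SemiSlant

/-- The (Wirtinger) angle in `[0, π/2]` between a vector `w` and a subspace `W`: the angle between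
`w` and its orthogonal projection to `W`, which is `π/2` when that projection vanishes. -/
def angleWithSubspace {V : Type*} [NormedAddCommGroup V] [InnerProductSpace ℝ V]
    (w : V) (W : Submodule ℝ V) [W.HasOrthogonalProjection] : ℝ :=
  InnerProductGeometry.angle w (W.starProjection w)

section OneManifold

variable {E : Type*} [NormedAddCommGroup E] [NormedSpace ℝ E]
  {M : Type*} [TopologicalSpace M] [ChartedSpace E M] [IsManifold 𝓘(ℝ, E) ∞ M]

/-- A smooth vector field on `M`, i.e. an element of `Γ(TM)`. -/
def IsSmoothVectorField (X : ∀ p : M, TangentSpace 𝓘(ℝ, E) p) : Prop :=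
  ContMDiff 𝓘(ℝ, E) (𝓘(ℝ, E).prod 𝓘(ℝ, E)) ∞
    (fun p ↦ (TotalSpace.mk' E p (X p) : TangentBundle 𝓘(ℝ, E) M))

/-- `X ∈ Γ(D)`: a smooth vector field on `M` with values in the distribution `D`. -/
def IsSection (D : ∀ p : M, Submodule ℝ (TangentSpace 𝓘(ℝ, E) p))
    (X : ∀ p : M, TangentSpace 𝓘(ℝ, E) p) : Prop :=
  IsSmoothVectorField X ∧ ∀ p, X p ∈ D p

/-- `D` is a smooth distribution of rank `k` on `M`: each `D p` has dimension `k`, and near each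
point `D` is spanned by `k` smooth vector fields. -/
structure IsSmoothDistribution (k : ℕ)
    (D : ∀ p : M, Submodule ℝ (TangentSpace 𝓘(ℝ, E) p)) : Prop where
  finrank_eq : ∀ p, Module.finrank ℝ (D p) = k
  local_frame : ∀ p₀ : M, ∃ U : Set M, IsOpen U ∧ p₀ ∈ U ∧
    ∃ X : Fin k → ∀ p : M, TangentSpace 𝓘(ℝ, E) p,
      (∀ i, ContMDiffOn 𝓘(ℝ, E) (𝓘(ℝ, E).prod 𝓘(ℝ, E)) ∞
        (fun p ↦ (TotalSpace.mk' E p (X i p) : TangentBundle 𝓘(ℝ, E) M)) U) ∧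
      ∀ p ∈ U, D p = Submodule.span ℝ (Set.range fun i ↦ X i p)

/-- The distribution `D` is integrable: `[X, Y] ∈ Γ(D)` for all `X, Y ∈ Γ(D)`. -/
def IsIntegrable (D : ∀ p : M, Submodule ℝ (TangentSpace 𝓘(ℝ, E) p)) : Prop :=
  ∀ X Y : ∀ p : M, TangentSpace 𝓘(ℝ, E) p, IsSection D X → IsSection D Y →
    ∀ p, VectorField.mlieBracket 𝓘(ℝ, E) X Y p ∈ D p

end OneManifold

section Kaehler

variable {E' : Type*} [NormedAddCommGroup E'] [NormedSpace ℝ E'] [FiniteDimensional ℝ E']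
  {N : Type*} [TopologicalSpace N] [ChartedSpace E' N] [IsManifold 𝓘(ℝ, E') ∞ N]
  [RiemannianBundle (fun x : N ↦ TangentSpace 𝓘(ℝ, E') x)]
  [IsContMDiffRiemannianBundle 𝓘(ℝ, E') ∞ E' (fun x : N ↦ TangentSpace 𝓘(ℝ, E') x)]

/-- `nabla` is the Levi-Civita connection of the Riemannian manifold `N`: it is torsion-free and
compatible with the metric. Here `nabla Y x v` is `(∇_v Y)(x)`, and
the second condition reads `v(g(Y, Z)) = g(∇_v Y, Z) + g(Y, ∇_v Z)`. -/
structure IsLeviCivita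
    (nabla : CovariantDerivative 𝓘(ℝ, E') E' (fun x : N ↦ TangentSpace 𝓘(ℝ, E') x)) : Prop where
  torsion_eq_zero : nabla.torsion = 0
  metric : ∀ (Y Z : ∀ x : N, TangentSpace 𝓘(ℝ, E') x) (x : N),
    MDifferentiableAt 𝓘(ℝ, E') (𝓘(ℝ, E').prod 𝓘(ℝ, E'))
      (fun y ↦ (TotalSpace.mk' E' y (Y y) : TangentBundle 𝓘(ℝ, E') N)) x →
    MDifferentiableAt 𝓘(ℝ, E') (𝓘(ℝ, E').prod 𝓘(ℝ, E'))
      (fun y ↦ (TotalSpace.mk' E' y (Z y) : TangentBundle 𝓘(ℝ, E') N)) x →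
    ∀ v, mvfderiv 𝓘(ℝ, E') (fun y ↦ (inner ℝ (Y y) (Z y) : ℝ)) x v
      = inner ℝ (nabla Y x v) (Z x) + inner ℝ (Y x) (nabla Z x v)

/-- `(N, g, J)`, with Levi-Civita connection `nabla`, is a Kaehler manifold: `J` is a smooth tensor
field of type `(1,1)` with `J² = -1`, `g(JX, JY) = g(X, Y)` and `(∇_X J) Y = 0`, the last condition
being `∇_X (JY) = J (∇_X Y)`. -/
structure IsKaehler (J : ∀ x : N, TangentSpace 𝓘(ℝ, E') x →L[ℝ] TangentSpace 𝓘(ℝ, E') x)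
    (nabla : CovariantDerivative 𝓘(ℝ, E') E' (fun x : N ↦ TangentSpace 𝓘(ℝ, E') x)) : Prop where
  leviCivita : IsLeviCivita nabla
  smooth : ContMDiff 𝓘(ℝ, E') (𝓘(ℝ, E').prod 𝓘(ℝ, E' →L[ℝ] E')) ∞
    (fun x ↦ TotalSpace.mk' (E' →L[ℝ] E')
      (E := fun x : N ↦ TangentSpace 𝓘(ℝ, E') x →L[ℝ] TangentSpace 𝓘(ℝ, E') x) x (J x))
  sq : ∀ x v, J x (J x v) = -v
  inner_map : ∀ (x : N) (v w : TangentSpace 𝓘(ℝ, E') x), inner ℝ (J x v) (J x w) = inner ℝ v w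
  parallel : ∀ (Y : ∀ x : N, TangentSpace 𝓘(ℝ, E') x) (x : N),
    MDifferentiableAt 𝓘(ℝ, E') (𝓘(ℝ, E').prod 𝓘(ℝ, E'))
      (fun y ↦ (TotalSpace.mk' E' y (Y y) : TangentBundle 𝓘(ℝ, E') N)) x →
    ∀ v, nabla (fun y ↦ J y (Y y)) x v = J x (nabla Y x v)

end Kaehler

section Submanifold

variable {E : Type*} [NormedAddCommGroup E] [NormedSpace ℝ E] [FiniteDimensional ℝ E]
  {M : Type*} [TopologicalSpace M] [ChartedSpace E M]
  [RiemannianBundle (fun p : M ↦ TangentSpace 𝓘(ℝ, E) p)]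
  {E' : Type*} [NormedAddCommGroup E'] [NormedSpace ℝ E'] [FiniteDimensional ℝ E']
  {N : Type*} [TopologicalSpace N] [ChartedSpace E' N]
  [RiemannianBundle (fun x : N ↦ TangentSpace 𝓘(ℝ, E') x)]

variable (E E') in
/-- `f : M → N` is a (smooth) isometric immersion; injectivity of the differential follows from
the preservation of the metric. -/
structure IsIsometricImmersion (f : M → N) : Prop where
  smooth : ContMDiff 𝓘(ℝ, E) 𝓘(ℝ, E') ∞ f
  inner_map : ∀ (p : M) (v w : TangentSpace 𝓘(ℝ, E) p),
    inner ℝ (mfderiv 𝓘(ℝ, E) 𝓘(ℝ, E') f p v) (mfderiv 𝓘(ℝ, E) 𝓘(ℝ, E') f p w) = inner ℝ v w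

/-- The differential of `f` at `p`, as a linear map between tangent spaces. -/
def push (f : M → N) (p : M) : TangentSpace 𝓘(ℝ, E) p →ₗ[ℝ] TangentSpace 𝓘(ℝ, E') (f p) :=
  (mfderiv 𝓘(ℝ, E) 𝓘(ℝ, E') f p).toLinearMap

/-- The tangential component of an ambient vector `w` at `f p`, as a vector tangent to `M`.
When `df` is isometric, its adjoint is the orthogonal projection to `df (T_p M) ≅ T_p M`:
see `tan_push` and `inner_nor_push`. -/
def tan (f : M → N) (p : M) (w : TangentSpace 𝓘(ℝ, E') (f p)) : TangentSpace 𝓘(ℝ, E) p :=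
  LinearMap.adjoint (push (E := E) (E' := E') f p) w

variable (E) in
/-- The normal component of an ambient vector `w` at `f p`. -/
def nor (f : M → N) (p : M) (w : TangentSpace 𝓘(ℝ, E') (f p)) : TangentSpace 𝓘(ℝ, E') (f p) :=
  w - push f p (tan f p w : TangentSpace 𝓘(ℝ, E) p)

theorem tan_push {f : M → N} (hf : IsIsometricImmersion E E' f) (p : M)
    (v : TangentSpace 𝓘(ℝ, E) p) :
    tan f p (push f p v : TangentSpace 𝓘(ℝ, E') (f p)) = v := by
  refine ext_inner_right ℝ fun u ↦ ?_
  rw [tan, LinearMap.adjoint_inner_left]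
  exact hf.inner_map p v u

theorem inner_nor_push {f : M → N} (hf : IsIsometricImmersion E E' f) (p : M)
    (w : TangentSpace 𝓘(ℝ, E') (f p)) (v : TangentSpace 𝓘(ℝ, E) p) :
    inner ℝ (nor E f p w) (push f p v) = 0 := by
  have h1 : inner ℝ (push f p (tan f p w)) (push f p v) = inner ℝ (tan f p w) v :=
    hf.inner_map p _ v
  rw [nor, inner_sub_left, h1, tan, LinearMap.adjoint_inner_left, sub_self]

variable [IsManifold 𝓘(ℝ, E) ∞ M] [IsManifold 𝓘(ℝ, E') ∞ N]

/-- The covariant derivative `∇_v Y` at `p`, for `v ∈ T_p M`, of a vector field `Y` of `N` along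
`f : M → N`. In the local trivialization of `TN` at `f p`, with frame `(e_i)`, write
`Y = ∑ yⁱ (e_i ∘ f)`; then `∇_v Y = ∑ dyⁱ(v) e_i + ∑ yⁱ(p) ∇_{df v} e_i`. The second sum is the
covariant derivative of the field with constant coefficients `yⁱ(p)`, which is
`FiberBundle.extend E' (Y p)`. -/
def covAlong (nabla : CovariantDerivative 𝓘(ℝ, E') E' (fun x : N ↦ TangentSpace 𝓘(ℝ, E') x))
    (f : M → N) (Y : ∀ p : M, TangentSpace 𝓘(ℝ, E') (f p)) (p : M)
    (v : TangentSpace 𝓘(ℝ, E) p) : TangentSpace 𝓘(ℝ, E') (f p) :=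
  letI e := trivializationAt E' (fun x : N ↦ TangentSpace 𝓘(ℝ, E') x) (f p)
  e.symm (f p) (mvfderiv 𝓘(ℝ, E) (fun q : M ↦ (e ⟨f q, Y q⟩).2) p v)
    + nabla (FiberBundle.extend E' (Y p)) (f p) (push f p v)

/-- The second fundamental form: by the Gauss formula, `h(X, Y)` is the normal component of
`∇_X Y`, the covariant derivative being that of `N`. -/
def secondForm (nabla : CovariantDerivative 𝓘(ℝ, E') E' (fun x : N ↦ TangentSpace 𝓘(ℝ, E') x))
    (f : M → N) (X Y : ∀ p : M, TangentSpace 𝓘(ℝ, E) p) (p : M) :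
    TangentSpace 𝓘(ℝ, E') (f p) :=
  nor E f p (covAlong nabla f (fun q ↦ push f q (Y q)) p (X p))

/-- The shape operator: by the Weingarten formula, for a normal field `ξ` along `f`, `A_ξ X` is
minus the tangential component of `∇_X ξ`. -/
def shape (nabla : CovariantDerivative 𝓘(ℝ, E') E' (fun x : N ↦ TangentSpace 𝓘(ℝ, E') x))
    (f : M → N) (ξ : ∀ p : M, TangentSpace 𝓘(ℝ, E') (f p))
    (X : ∀ p : M, TangentSpace 𝓘(ℝ, E) p) (p : M) : TangentSpace 𝓘(ℝ, E) p :=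
  -tan f p (covAlong nabla f ξ p (X p))

/-- `T X`, the tangential component of `J X`. On a distribution with `J D = D` this is `J X`
itself, regarded as a vector field on `M`. -/
def opT (J : ∀ x : N, TangentSpace 𝓘(ℝ, E') x →L[ℝ] TangentSpace 𝓘(ℝ, E') x) (f : M → N)
    (X : ∀ p : M, TangentSpace 𝓘(ℝ, E) p) (p : M) : TangentSpace 𝓘(ℝ, E) p :=
  tan f p (J (f p) (push f p (X p)))

/-- `F X`, the normal component of `J X`. -/
def opF (J : ∀ x : N, TangentSpace 𝓘(ℝ, E') x →L[ℝ] TangentSpace 𝓘(ℝ, E') x) (f : M → N)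
    (X : ∀ p : M, TangentSpace 𝓘(ℝ, E) p) (p : M) : TangentSpace 𝓘(ℝ, E') (f p) :=
  nor E f p (J (f p) (push f p (X p)))

/-- The distribution `D` is pointwise slant with slant function `θ`: for every `p` and every
nonzero `v ∈ D p`, the angle between `J v` and `D p` is `θ p`. -/
def IsPointwiseSlant (J : ∀ x : N, TangentSpace 𝓘(ℝ, E') x →L[ℝ] TangentSpace 𝓘(ℝ, E') x)
    (f : M → N) (D : ∀ p : M, Submodule ℝ (TangentSpace 𝓘(ℝ, E) p)) (θ : M → ℝ) : Prop :=
  ∀ (p : M), ∀ v ∈ D p, v ≠ 0 →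
    angleWithSubspace (J (f p) (push f p v)) ((D p).map (push f p)) = θ p

/-- `M`, isometrically immersed in `N` by `f`, is a pointwise semi-slant submanifold with holomorphic
distribution `DT` of rank `m₁` and pointwise slant distribution `Dθ` of rank `m₂`, with slant
function `θ`. -/
structure IsPointwiseSemiSlant
    (J : ∀ x : N, TangentSpace 𝓘(ℝ, E') x →L[ℝ] TangentSpace 𝓘(ℝ, E') x) (f : M → N)
    (DT Dθ : ∀ p : M, Submodule ℝ (TangentSpace 𝓘(ℝ, E) p)) (m₁ m₂ : ℕ) (θ : M → ℝ) : Prop where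
  distribution_T : IsSmoothDistribution m₁ DT
  distribution_θ : IsSmoothDistribution m₂ Dθ
  orthogonal : ∀ p, ∀ u ∈ DT p, ∀ v ∈ Dθ p, inner ℝ u v = 0
  isCompl : ∀ p, IsCompl (DT p) (Dθ p)
  holomorphic : ∀ p, ((DT p).map (push f p)).map (J (f p)).toLinearMap = (DT p).map (push f p)
  slant : IsPointwiseSlant J f Dθ θ

/-- A pointwise semi-slant submanifold is proper if `m₁ ≠ 0` and `θ` is not constant. -/
structure IsProperPointwiseSemiSlant
    (J : ∀ x : N, TangentSpace 𝓘(ℝ, E') x →L[ℝ] TangentSpace 𝓘(ℝ, E') x) (f : M → N)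
    (DT Dθ : ∀ p : M, Submodule ℝ (TangentSpace 𝓘(ℝ, E) p)) (m₁ m₂ : ℕ) (θ : M → ℝ) : Prop
    extends IsPointwiseSemiSlant J f DT Dθ m₁ m₂ θ where
  rank_ne_zero : m₁ ≠ 0
  not_constant : ¬ ∃ c : ℝ, ∀ p, θ p = c

end Submanifold

end SemiSlant

end

open Bundle Manifold
open scoped ContDiff

set_option linter.unusedSectionVars false

noncomputable section

/-! Write JV = TV + FV. On Dθ the slant condition amounts to T² = -cos²θ (`tanJ_tanJ`). Expanding
g(w, V) = g(Jw, JV) and moving J across in the term g(Jw, TV) gives, for every ambient vector w and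
every V in Dθ, sin²θ g(w, V) = g(Jw, FV) - g(w, FTV) (`sin_sq_mul_inner`). Both parts come from this
identity.

For (i) take w = [X, Y]. It is tangent, so the last term drops. As J is parallel and ∇ is
torsion-free, J[X, Y] = ∇_X JY - ∇_Y JX, which differs from ∇_X JY - ∇_{JX} Y by a tangent vector.
Hence sin²θ g([X, Y], V) = g(h(X, JY) - h(JX, Y), FV). For (ii), orthogonality of the distributions
turns g([V, W], X) into g(∇_W X, V) - g(∇_V X, W). The identity with w = ∇_V X and w = ∇_W X,
followed by the Weingarten relation, produces the shape operators.

Integrability means that brackets are orthogonal to the complementary distribution. The factor sin²θ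
is cancelled on the dense set where it is nonzero, and continuity does the rest
(`isIntegrable_iff_of_dense`).

These computations need the calculus of ∇ along f. Near a point every field along f is a combination
of restrictions of ambient fields (`DiffAlongAt.induction`), which transfers ∇g = 0 and ∇J = 0.
Vanishing torsion along f follows from tensoriality and the symmetry of second derivatives
(`covAlong_push_sub_covAlong_push`). -/

namespace SemiSlant

open Filter Topology


/-! ### Differentiable vector fields along a map -/

section Along

variable {E : Type*} [NormedAddCommGroup E] [NormedSpace ℝ E]
  {M : Type*} [TopologicalSpace M] [ChartedSpace E M]
  {E' : Type*} [NormedAddCommGroup E'] [NormedSpace ℝ E']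
  {N : Type*} [TopologicalSpace N] [ChartedSpace E' N] [IsManifold 𝓘(ℝ, E') ∞ N]

variable (E E') in
/-- The vector field `Y` of `N` along `f : M → N` is differentiable at `p`. -/
def DiffAlongAt (f : M → N) (Y : ∀ p : M, TangentSpace 𝓘(ℝ, E') (f p)) (p : M) : Prop :=
  MDifferentiableAt 𝓘(ℝ, E) (𝓘(ℝ, E').prod 𝓘(ℝ, E'))
    (fun q ↦ (TotalSpace.mk' E' (f q) (Y q) : TangentBundle 𝓘(ℝ, E') N)) p

/-- The coordinates of a vector field along `f` in the local trivialization of `TN` at `f p`. -/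
def alongCoord (f : M → N) (p : M) (Y : ∀ p : M, TangentSpace 𝓘(ℝ, E') (f p)) (q : M) : E' :=
  (trivializationAt E' (fun x : N ↦ TangentSpace 𝓘(ℝ, E') x) (f p) ⟨f q, Y q⟩).2

variable {f : M → N} {p : M} {Y Z : ∀ p : M, TangentSpace 𝓘(ℝ, E') (f p)}

theorem diffAlongAt_iff :
    DiffAlongAt E E' f Y p ↔ MDifferentiableAt 𝓘(ℝ, E) 𝓘(ℝ, E') f p ∧
      MDifferentiableAt 𝓘(ℝ, E) 𝓘(ℝ, E') (alongCoord f p Y) p :=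
  mdifferentiableAt_totalSpace 𝓘(ℝ, E') _

theorem DiffAlongAt.base (h : DiffAlongAt E E' f Y p) :
    MDifferentiableAt 𝓘(ℝ, E) 𝓘(ℝ, E') f p :=
  (diffAlongAt_iff.1 h).1

theorem DiffAlongAt.coord (h : DiffAlongAt E E' f Y p) :
    MDifferentiableAt 𝓘(ℝ, E) 𝓘(ℝ, E') (alongCoord f p Y) p :=
  (diffAlongAt_iff.1 h).2

theorem eventually_mem_baseSet (hf : MDifferentiableAt 𝓘(ℝ, E) 𝓘(ℝ, E') f p) :
    ∀ᶠ q in 𝓝 p,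
      f q ∈ (trivializationAt E' (fun x : N ↦ TangentSpace 𝓘(ℝ, E') x) (f p)).baseSet :=
  hf.continuousAt.preimage_mem_nhds
    ((trivializationAt E' (fun x : N ↦ TangentSpace 𝓘(ℝ, E') x) (f p)).open_baseSet.mem_nhds
      (FiberBundle.mem_baseSet_trivializationAt' (f p)))

/-- Only an equality of germs: the trivialization at `f p` is linear on fibres over its base set,
which contains `f q` only for `q` near `p`. -/
theorem alongCoord_add_eventuallyEq (hf : MDifferentiableAt 𝓘(ℝ, E) 𝓘(ℝ, E') f p) :
    alongCoord f p (fun q ↦ Y q + Z q) =ᶠ[𝓝 p] alongCoord f p Y + alongCoord f p Z := by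
  filter_upwards [eventually_mem_baseSet hf] with q hq
  exact ((trivializationAt E' (fun x : N ↦ TangentSpace 𝓘(ℝ, E') x) (f p)).linear ℝ hq).map_add _ _

theorem alongCoord_smul_eventuallyEq (hf : MDifferentiableAt 𝓘(ℝ, E) 𝓘(ℝ, E') f p) (g : M → ℝ) :
    alongCoord f p (fun q ↦ g q • Y q) =ᶠ[𝓝 p] g • alongCoord f p Y := by
  filter_upwards [eventually_mem_baseSet hf] with q hq
  exact ((trivializationAt E' (fun x : N ↦ TangentSpace 𝓘(ℝ, E') x) (f p)).linear ℝ hq).map_smul _ _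

theorem DiffAlongAt.add (hY : DiffAlongAt E E' f Y p) (hZ : DiffAlongAt E E' f Z p) :
    DiffAlongAt E E' f (fun q ↦ Y q + Z q) p :=
  diffAlongAt_iff.2 ⟨hY.base,
    (hY.coord.add hZ.coord).congr_of_eventuallyEq (alongCoord_add_eventuallyEq hY.base)⟩

theorem DiffAlongAt.smul {g : M → ℝ} (hg : MDifferentiableAt 𝓘(ℝ, E) 𝓘(ℝ) g p)
    (hY : DiffAlongAt E E' f Y p) : DiffAlongAt E E' f (fun q ↦ g q • Y q) p :=
  diffAlongAt_iff.2 ⟨hY.base,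
    (hg.smul hY.coord).congr_of_eventuallyEq (alongCoord_smul_eventuallyEq hY.base g)⟩

theorem DiffAlongAt.sub (hY : DiffAlongAt E E' f Y p) (hZ : DiffAlongAt E E' f Z p) :
    DiffAlongAt E E' f (fun q ↦ Y q - Z q) p := by
  have := hY.add (hZ.smul (g := fun _ ↦ (-1 : ℝ)) mdifferentiableAt_const)
  simpa [sub_eq_add_neg] using this

theorem diffAlongAt_comp {S : ∀ x : N, TangentSpace 𝓘(ℝ, E') x}
    (hf : MDifferentiableAt 𝓘(ℝ, E) 𝓘(ℝ, E') f p)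
    (hS : MDifferentiableAt 𝓘(ℝ, E') (𝓘(ℝ, E').prod 𝓘(ℝ, E'))
      (fun y ↦ (TotalSpace.mk' E' y (S y) : TangentBundle 𝓘(ℝ, E') N)) (f p)) :
    DiffAlongAt E E' f (fun q ↦ S (f q)) p :=
  MDifferentiableAt.comp p hS hf

theorem DiffAlongAt.zero (hf : MDifferentiableAt 𝓘(ℝ, E) 𝓘(ℝ, E') f p) :
    DiffAlongAt E E' f (fun _ ↦ 0) p :=
  diffAlongAt_comp (S := fun _ ↦ 0) hf (mdifferentiableAt_zeroSection ..)

theorem DiffAlongAt.sum {ι : Type*} (s : Finset ι) {Y : ι → ∀ p : M, TangentSpace 𝓘(ℝ, E') (f p)}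
    (hf : MDifferentiableAt 𝓘(ℝ, E) 𝓘(ℝ, E') f p)
    (hY : ∀ i, DiffAlongAt E E' f (Y i) p) :
    DiffAlongAt E E' f (fun q ↦ ∑ i ∈ s, Y i q) p := by
  classical
  induction s using Finset.induction_on with
  | empty => simpa using DiffAlongAt.zero hf
  | insert a s ha ih => simpa [Finset.sum_insert ha] using (hY a).add ih

/-- A property of vector fields along `f` which is local, additive, stable under multiplication
by functions and true for the restrictions of vector fields of `N`, is true for all vector fields
along `f`. -/
theorem DiffAlongAt.induction [FiniteDimensional ℝ E']
    {P : (∀ p : M, TangentSpace 𝓘(ℝ, E') (f p)) → Prop}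
    (hY : DiffAlongAt E E' f Y p)
    (congr : ∀ Y Z, DiffAlongAt E E' f Y p → (∀ᶠ q in 𝓝 p, Z q = Y q) → P Y → P Z)
    (add : ∀ Y Z, DiffAlongAt E E' f Y p → DiffAlongAt E E' f Z p → P Y → P Z →
      P (fun q ↦ Y q + Z q))
    (smul : ∀ (g : M → ℝ) Y, MDifferentiableAt 𝓘(ℝ, E) 𝓘(ℝ) g p → DiffAlongAt E E' f Y p →
      P Y → P (fun q ↦ g q • Y q))
    (comp : ∀ S : ∀ x : N, TangentSpace 𝓘(ℝ, E') x,
      MDifferentiableAt 𝓘(ℝ, E') (𝓘(ℝ, E').prod 𝓘(ℝ, E'))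
        (fun y ↦ (TotalSpace.mk' E' y (S y) : TangentBundle 𝓘(ℝ, E') N)) (f p) →
      P (fun q ↦ S (f q))) : P Y := by
  classical
  set e := trivializationAt E' (fun x : N ↦ TangentSpace 𝓘(ℝ, E') x) (f p)
  let b := Module.finBasis ℝ E'
  -- Near `f p` the field `S i` has constant coordinates `b i`, so `Y` is locally the sum of the `S
  -- i ∘ f` weighted by its own coordinates `c i`.
  let S (i) : ∀ x : N, TangentSpace 𝓘(ℝ, E') x :=
    FiberBundle.extend E' (e.symm (f p) (b i) : TangentSpace 𝓘(ℝ, E') (f p))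
  have hS (i) := FiberBundle.mdifferentiableAt_extend 𝓘(ℝ, E') E'
    (e.symm (f p) (b i) : TangentSpace 𝓘(ℝ, E') (f p))
  let c (i) (q : M) : ℝ := b.repr (alongCoord f p Y q) i
  have hc (i) : MDifferentiableAt 𝓘(ℝ, E) 𝓘(ℝ) (c i) p :=
    ((b.coord i).toContinuousLinearMap.differentiableAt).comp_mdifferentiableAt hY.coord
  have hd (i) : DiffAlongAt E E' f (fun q ↦ c i q • S i (f q)) p :=
    (diffAlongAt_comp hY.base (hS i)).smul (hc i)
  have key (s : Finset (Fin (Module.finrank ℝ E'))) : P (fun q ↦ ∑ i ∈ s, c i q • S i (f q)) := by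
    induction s using Finset.induction_on with
    | empty => simpa using comp (fun _ ↦ 0) (mdifferentiableAt_zeroSection ..)
    | insert a s ha ih =>
      simp only [Finset.sum_insert ha]
      exact add _ _ (hd a) (DiffAlongAt.sum s hY.base hd) (smul _ _ (hc a)
        (diffAlongAt_comp hY.base (hS a)) (comp _ (hS a))) ih
  refine congr _ _ (DiffAlongAt.sum Finset.univ hY.base hd) ?_ (key Finset.univ)
  filter_upwards [eventually_mem_baseSet hY.base] with q hq
  have hp : f p ∈ e.baseSet := FiberBundle.mem_baseSet_trivializationAt' (f p)
  have h1 (i) : S i (f q) = e.symmL ℝ (f q) (b i) := by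
    rw [e.symmL_apply hq]
    change e.symm (f q) (e ⟨f p, e.symm (f p) (b i)⟩).2 = e.symm (f q) (b i)
    rw [e.apply_mk_symm hp]
  calc Y q = e.symmL ℝ (f q) (alongCoord f p Y q) := by
        rw [e.symmL_apply hq]
        exact (e.symm_apply_apply_mk hq (Y q)).symm
    _ = e.symmL ℝ (f q) (∑ i, c i q • b i) := by rw [b.sum_repr]
    _ = _ := by simp only [map_sum, map_smul, h1]

end Along

/-! ### The covariant derivative along a map -/

section CovAlong

variable {E : Type*} [NormedAddCommGroup E] [NormedSpace ℝ E]
  {M : Type*} [TopologicalSpace M] [ChartedSpace E M]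
  {E' : Type*} [NormedAddCommGroup E'] [NormedSpace ℝ E']
  {N : Type*} [TopologicalSpace N] [ChartedSpace E' N] [IsManifold 𝓘(ℝ, E') ∞ N]
  {nabla : CovariantDerivative 𝓘(ℝ, E') E' (fun x : N ↦ TangentSpace 𝓘(ℝ, E') x)}
  {f : M → N} {p : M} {Y Z : ∀ p : M, TangentSpace 𝓘(ℝ, E') (f p)}

/-- Trades the bare function `e.symm` for the continuous linear map `symmL`, which makes linearity
available. -/
theorem covAlong_eq (v : TangentSpace 𝓘(ℝ, E) p) :
    covAlong nabla f Y p v =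
      (trivializationAt E' (fun x : N ↦ TangentSpace 𝓘(ℝ, E') x) (f p)).symmL ℝ (f p)
        (mvfderiv 𝓘(ℝ, E) (alongCoord f p Y) p v)
      + nabla (FiberBundle.extend E' (Y p)) (f p) (push f p v) := by
  rw [Trivialization.symmL_apply _ (FiberBundle.mem_baseSet_trivializationAt' (f p))]
  rfl

theorem mvfderiv_congr {F : Type*} [NormedAddCommGroup F] [NormedSpace ℝ F] {g h : M → F}
    (hgh : g =ᶠ[𝓝 p] h) : mvfderiv 𝓘(ℝ, E) g p = mvfderiv 𝓘(ℝ, E) h p := by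
  unfold mvfderiv
  rw [hgh.mfderiv_eq, hgh.self_of_nhds]

theorem covAlong_congr (h : ∀ᶠ q in 𝓝 p, Z q = Y q) (v : TangentSpace 𝓘(ℝ, E) p) :
    covAlong nabla f Z p v = covAlong nabla f Y p v := by
  have h1 : alongCoord f p Z =ᶠ[𝓝 p] alongCoord f p Y := by
    filter_upwards [h] with q hq
    rw [alongCoord, alongCoord, hq]
  rw [covAlong_eq, covAlong_eq, mvfderiv_congr h1, h.self_of_nhds]

/-- An extension has constant coordinates in the trivialization at `x`, hence depends linearly on
the vector over the base set. -/
theorem extend_add_eventuallyEq {x : N} (a b : TangentSpace 𝓘(ℝ, E') x) :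
    ∀ᶠ y in 𝓝 x, (FiberBundle.extend E' (a + b) : ∀ y : N, TangentSpace 𝓘(ℝ, E') y) y
      = (FiberBundle.extend E' a + FiberBundle.extend E' b :
          ∀ y : N, TangentSpace 𝓘(ℝ, E') y) y := by
  let e := trivializationAt E' (fun x : N ↦ TangentSpace 𝓘(ℝ, E') x) x
  have h := (e.linear ℝ (FiberBundle.mem_baseSet_trivializationAt' x)).map_add a b
  filter_upwards [e.open_baseSet.mem_nhds (FiberBundle.mem_baseSet_trivializationAt' x)] with y hy
  change e.symm y (e ⟨x, a + b⟩).2 = e.symm y (e ⟨x, a⟩).2 + e.symm y (e ⟨x, b⟩).2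
  simp only [← e.symmL_apply (R := ℝ) hy, h, map_add]

theorem extend_smul_eventuallyEq {x : N} (c : ℝ) (a : TangentSpace 𝓘(ℝ, E') x) :
    ∀ᶠ y in 𝓝 x, (FiberBundle.extend E' (c • a) : ∀ y : N, TangentSpace 𝓘(ℝ, E') y) y
      = (c • FiberBundle.extend E' a : ∀ y : N, TangentSpace 𝓘(ℝ, E') y) y := by
  let e := trivializationAt E' (fun x : N ↦ TangentSpace 𝓘(ℝ, E') x) x
  have h := (e.linear ℝ (FiberBundle.mem_baseSet_trivializationAt' x)).map_smul c a
  filter_upwards [e.open_baseSet.mem_nhds (FiberBundle.mem_baseSet_trivializationAt' x)] with y hy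
  change e.symm y (e ⟨x, c • a⟩).2 = c • e.symm y (e ⟨x, a⟩).2
  simp only [← e.symmL_apply (R := ℝ) hy, h, map_smul]

/-- The connection sees only germs, so the local additivity of extensions suffices. This handles the
zeroth-order term of `covAlong`. -/
theorem nabla_extend_add {x : N} (a b : TangentSpace 𝓘(ℝ, E') x) :
    nabla (FiberBundle.extend E' (a + b)) x
      = nabla (FiberBundle.extend E' a) x + nabla (FiberBundle.extend E' b) x := by
  have ha := FiberBundle.mdifferentiableAt_extend 𝓘(ℝ, E') E' a
  have hb := FiberBundle.mdifferentiableAt_extend 𝓘(ℝ, E') E' b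
  rw [← nabla.isCovariantDerivativeOnUniv.add ha hb]
  exact nabla.isCovariantDerivativeOnUniv.congr_of_eventuallyEq
    (FiberBundle.mdifferentiableAt_extend ..) (mdifferentiableAt_add_section ha hb)
    univ_mem (extend_add_eventuallyEq a b)

theorem nabla_extend_smul {x : N} (c : ℝ) (a : TangentSpace 𝓘(ℝ, E') x) :
    nabla (FiberBundle.extend E' (c • a)) x = c • nabla (FiberBundle.extend E' a) x := by
  have ha := FiberBundle.mdifferentiableAt_extend 𝓘(ℝ, E') E' a
  rw [← nabla.isCovariantDerivativeOnUniv.smul_const c ha]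
  exact nabla.isCovariantDerivativeOnUniv.congr_of_eventuallyEq
    (FiberBundle.mdifferentiableAt_extend ..) (mdifferentiableAt_const.smul_section ha)
    univ_mem (extend_smul_eventuallyEq c a)

theorem symmL_alongCoord (q : M) :
    (trivializationAt E' (fun x : N ↦ TangentSpace 𝓘(ℝ, E') x) (f q)).symmL ℝ (f q)
      (alongCoord f q Y q) = Y q := by
  rw [Trivialization.symmL_apply _ (FiberBundle.mem_baseSet_trivializationAt' (f q))]
  exact (trivializationAt E' (fun x : N ↦ TangentSpace 𝓘(ℝ, E') x) (f q)).symm_apply_apply_mk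
    (FiberBundle.mem_baseSet_trivializationAt' (f q)) (Y q)

theorem covAlong_add (hY : DiffAlongAt E E' f Y p) (hZ : DiffAlongAt E E' f Z p)
    (v : TangentSpace 𝓘(ℝ, E) p) :
    covAlong nabla f (fun q ↦ Y q + Z q) p v
      = covAlong nabla f Y p v + covAlong nabla f Z p v := by
  simp only [covAlong_eq]
  rw [mvfderiv_congr (alongCoord_add_eventuallyEq hY.base), mvfderiv_add hY.coord hZ.coord,
    nabla_extend_add, add_apply,
    add_apply, map_add]
  abel

theorem covAlong_smul {g : M → ℝ} (hg : MDifferentiableAt 𝓘(ℝ, E) 𝓘(ℝ) g p)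
    (hY : DiffAlongAt E E' f Y p) (v : TangentSpace 𝓘(ℝ, E) p) :
    covAlong nabla f (fun q ↦ g q • Y q) p v
      = mvfderiv 𝓘(ℝ, E) g p v • Y p + g p • covAlong nabla f Y p v := by
  simp only [covAlong_eq]
  rw [mvfderiv_congr (alongCoord_smul_eventuallyEq hY.base g), mvfderiv_smul hg hY.coord,
    nabla_extend_smul]
  have h := symmL_alongCoord (f := f) (Y := Y) p
  simp only [add_apply, smul_apply,
    ContinuousLinearMap.smulRight_apply, map_add, map_smul, smul_add, h]
  abel

theorem alongCoord_extend_eventuallyEq (hf : MDifferentiableAt 𝓘(ℝ, E) 𝓘(ℝ, E') f p)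
    (a : TangentSpace 𝓘(ℝ, E') (f p)) :
    alongCoord f p (fun q ↦ FiberBundle.extend E' a (f q)) =ᶠ[𝓝 p]
      fun _ ↦ (trivializationAt E' (fun x : N ↦ TangentSpace 𝓘(ℝ, E') x) (f p) ⟨f p, a⟩).2 := by
  filter_upwards [eventually_mem_baseSet hf] with q hq
  unfold alongCoord FiberBundle.extend
  rw [Trivialization.apply_mk_symm _ hq]

/-- The covariant derivative along `f` of the restriction of a vector field of `N`. -/
theorem covAlong_comp [FiniteDimensional ℝ E'] {S : ∀ x : N, TangentSpace 𝓘(ℝ, E') x}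
    (hf : MDifferentiableAt 𝓘(ℝ, E) 𝓘(ℝ, E') f p)
    (hS : MDifferentiableAt 𝓘(ℝ, E') (𝓘(ℝ, E').prod 𝓘(ℝ, E'))
      (fun y ↦ (TotalSpace.mk' E' y (S y) : TangentBundle 𝓘(ℝ, E') N)) (f p))
    (v : TangentSpace 𝓘(ℝ, E) p) :
    covAlong nabla f (fun q ↦ S (f q)) p v = nabla S (f p) (push f p v) := by
  -- The Leibniz terms of the two sides cancel, so their difference depends only on `S (f p)`. It
  -- can be computed on the extension of that vector, whose coordinates along `f` are constant.
  have hT : TensorialAt 𝓘(ℝ, E') E'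
      (fun S : ∀ x : N, TangentSpace 𝓘(ℝ, E') x ↦
        covAlong nabla f (fun q ↦ S (f q)) p v - nabla S (f p) (push f p v)) (f p) := by
    refine ⟨fun {g S} hg hS ↦ ?_, fun {S S'} hS hS' ↦ ?_⟩
    · have h1 : covAlong nabla f (fun q ↦ (g • S) (f q)) p v
          = mvfderiv 𝓘(ℝ, E) (g ∘ f) p v • S (f p)
            + g (f p) • covAlong nabla f (fun q ↦ S (f q)) p v :=
        covAlong_smul (MDifferentiableAt.comp p hg hf) (diffAlongAt_comp hf hS) v
      have h2 : mvfderiv 𝓘(ℝ, E) (g ∘ f) p v = mvfderiv 𝓘(ℝ, E') g (f p) (push f p v) :=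
        mvfderiv_comp_apply p hg hf v
      rw [h1, h2, nabla.isCovariantDerivativeOnUniv.leibniz hS hg]
      simp only [add_apply, smul_apply, ContinuousLinearMap.smulRight_apply, smul_sub]
      abel
    · have h1 : covAlong nabla f (fun q ↦ (S + S') (f q)) p v
          = covAlong nabla f (fun q ↦ S (f q)) p v + covAlong nabla f (fun q ↦ S' (f q)) p v :=
        covAlong_add (diffAlongAt_comp hf hS) (diffAlongAt_comp hf hS') v
      rw [h1, nabla.isCovariantDerivativeOnUniv.add hS hS', add_apply]
      abel
  have h1 := hT.pointwise hS (FiberBundle.mdifferentiableAt_extend 𝓘(ℝ, E') E' (S (f p)))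
    (FiberBundle.extend_apply_self E' (S (f p))).symm
  have h2 : covAlong nabla f (fun q ↦ FiberBundle.extend E' (S (f p)) (f q)) p v
      = nabla (FiberBundle.extend E' (S (f p))) (f p) (push f p v) := by
    rw [covAlong_eq, mvfderiv_congr (alongCoord_extend_eventuallyEq hf _), mvfderiv_const,
      FiberBundle.extend_apply_self, zero_apply, map_zero, zero_add]
  simp only [h2, sub_self] at h1
  exact sub_eq_zero.1 h1

end CovAlong


/-! ### Metric and complex structure are parallel along a map -/

section Kaehler

variable {E : Type*} [NormedAddCommGroup E] [NormedSpace ℝ E]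
  {M : Type*} [TopologicalSpace M] [ChartedSpace E M]
  {E' : Type*} [NormedAddCommGroup E'] [NormedSpace ℝ E'] [FiniteDimensional ℝ E']
  {N : Type*} [TopologicalSpace N] [ChartedSpace E' N] [IsManifold 𝓘(ℝ, E') ∞ N]
  [RiemannianBundle (fun x : N ↦ TangentSpace 𝓘(ℝ, E') x)]
  [IsContMDiffRiemannianBundle 𝓘(ℝ, E') ∞ E' (fun x : N ↦ TangentSpace 𝓘(ℝ, E') x)]
  {nabla : CovariantDerivative 𝓘(ℝ, E') E' (fun x : N ↦ TangentSpace 𝓘(ℝ, E') x)}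
  {f : M → N} {p : M} {Y Z : ∀ p : M, TangentSpace 𝓘(ℝ, E') (f p)}

theorem DiffAlongAt.inner (hY : DiffAlongAt E E' f Y p) (hZ : DiffAlongAt E E' f Z p) :
    MDifferentiableAt 𝓘(ℝ, E) 𝓘(ℝ) (fun q ↦ (Inner.inner ℝ (Y q) (Z q) : ℝ)) p :=
  MDifferentiableAt.inner_bundle (F := E') (E := fun x : N ↦ TangentSpace 𝓘(ℝ, E') x)
    (IB := 𝓘(ℝ, E')) hY hZ

/-- The Levi-Civita connection is compatible with the metric along `f`. -/
theorem IsLeviCivita.mvfderiv_inner (h : IsLeviCivita nabla)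
    (hY : DiffAlongAt E E' f Y p) (hZ : DiffAlongAt E E' f Z p) (v : TangentSpace 𝓘(ℝ, E) p) :
    mvfderiv 𝓘(ℝ, E) (fun q ↦ (inner ℝ (Y q) (Z q) : ℝ)) p v
      = inner ℝ (covAlong nabla f Y p v) (Z p) + inner ℝ (Y p) (covAlong nabla f Z p v) := by
  have hf := hY.base
  -- Reduction to restrictions of ambient fields, first in `Y`, then in `Z`; there the claim is the
  -- ambient metric condition and the chain rule.
  refine hY.induction (P := fun Y : ∀ q, TangentSpace 𝓘(ℝ, E') (f q) ↦
      mvfderiv 𝓘(ℝ, E) (fun q ↦ (inner ℝ (Y q) (Z q) : ℝ)) p v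
      = inner ℝ (covAlong nabla f Y p v) (Z p) + inner ℝ (Y p) (covAlong nabla f Z p v))
    (fun Y Y' hY he ih ↦ ?_) (fun Y Y' hY hY' ih ih' ↦ ?_) (fun g Y hg hY ih ↦ ?_)
    (fun S hS ↦ ?_)
  · rw [covAlong_congr he, he.self_of_nhds, ← ih]
    refine DFunLike.congr_fun (mvfderiv_congr ?_) v
    filter_upwards [he] with q hq
    rw [hq]
  · simp only [inner_add_left]
    rw [mvfderiv_fun_add (hY.inner hZ) (hY'.inner hZ), add_apply, ih, ih', covAlong_add hY hY',
      inner_add_left]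
    ring
  · simp only [real_inner_smul_left]
    rw [mvfderiv_fun_mul hg (hY.inner hZ), covAlong_smul hg hY]
    simp only [add_apply, smul_apply, ih, inner_add_left, real_inner_smul_left, smul_eq_mul]
    ring
  · refine hZ.induction (P := fun Z : ∀ q, TangentSpace 𝓘(ℝ, E') (f q) ↦
        mvfderiv 𝓘(ℝ, E) (fun q ↦ (inner ℝ (S (f q)) (Z q) : ℝ)) p v
          = inner ℝ (covAlong nabla f (fun q ↦ S (f q)) p v) (Z p)
            + inner ℝ (S (f p)) (covAlong nabla f Z p v))
      (fun Z Z' hZ he ih ↦ ?_) (fun Z Z' hZ hZ' ih ih' ↦ ?_) (fun g Z hg hZ ih ↦ ?_)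
      (fun S' hS' ↦ ?_)
    · rw [covAlong_congr he, he.self_of_nhds, ← ih]
      refine DFunLike.congr_fun (mvfderiv_congr ?_) v
      filter_upwards [he] with q hq
      rw [hq]
    · have hY := diffAlongAt_comp hf hS
      simp only [inner_add_right]
      rw [mvfderiv_fun_add (hY.inner hZ) (hY.inner hZ'), add_apply, ih, ih', covAlong_add hZ hZ',
        inner_add_right]
      ring
    · have hY := diffAlongAt_comp hf hS
      simp only [real_inner_smul_right]
      rw [mvfderiv_fun_mul hg (hY.inner hZ), covAlong_smul hg hZ]
      simp only [add_apply, smul_apply, ih, inner_add_right, real_inner_smul_right, smul_eq_mul]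
      ring
    · rw [covAlong_comp hf hS, covAlong_comp hf hS']
      have h1 := h.metric S S' (f p) hS hS' (push f p v)
      rw [← h1]
      have hi : MDifferentiableAt 𝓘(ℝ, E') 𝓘(ℝ)
          (fun y ↦ (Inner.inner ℝ (S y) (S' y) : ℝ)) (f p) :=
        MDifferentiableAt.inner_bundle (F := E') (E := fun x : N ↦ TangentSpace 𝓘(ℝ, E') x)
          (IB := 𝓘(ℝ, E')) hS hS'
      exact mvfderiv_comp_apply p hi hf v

variable {J : ∀ x : N, TangentSpace 𝓘(ℝ, E') x →L[ℝ] TangentSpace 𝓘(ℝ, E') x}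

theorem IsKaehler.mdifferentiableAt_apply (h : IsKaehler J nabla)
    {S : ∀ x : N, TangentSpace 𝓘(ℝ, E') x} {x : N}
    (hS : MDifferentiableAt 𝓘(ℝ, E') (𝓘(ℝ, E').prod 𝓘(ℝ, E'))
      (fun y ↦ (TotalSpace.mk' E' y (S y) : TangentBundle 𝓘(ℝ, E') N)) x) :
    MDifferentiableAt 𝓘(ℝ, E') (𝓘(ℝ, E').prod 𝓘(ℝ, E'))
      (fun y ↦ (TotalSpace.mk' E' y (J y (S y)) : TangentBundle 𝓘(ℝ, E') N)) x :=
  MDifferentiableAt.clm_bundle_apply (F₁ := E') (F₂ := E') (b := fun y ↦ y)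
    ((h.smooth x).mdifferentiableAt (by simp)) hS

theorem IsKaehler.diffAlongAt_apply (h : IsKaehler J nabla) (hY : DiffAlongAt E E' f Y p) :
    DiffAlongAt E E' f (fun q ↦ J (f q) (Y q)) p :=
  MDifferentiableAt.clm_bundle_apply (F₁ := E') (F₂ := E') (b := f)
    (MDifferentiableAt.comp p ((h.smooth (f p)).mdifferentiableAt (by simp)) hY.base) hY

/-- The complex structure is parallel along `f`. -/
theorem IsKaehler.covAlong_apply (h : IsKaehler J nabla) (hY : DiffAlongAt E E' f Y p)
    (v : TangentSpace 𝓘(ℝ, E) p) :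
    covAlong nabla f (fun q ↦ J (f q) (Y q)) p v = J (f p) (covAlong nabla f Y p v) := by
  have hf := hY.base
  refine hY.induction (P := fun Y ↦ covAlong nabla f (fun q ↦ J (f q) (Y q)) p v
      = J (f p) (covAlong nabla f Y p v))
    (fun Y Y' hY he ih ↦ ?_) (fun Y Y' hY hY' ih ih' ↦ ?_) (fun g Y hg hY ih ↦ ?_)
    (fun S hS ↦ ?_)
  · rw [covAlong_congr he, ← ih]
    refine covAlong_congr ?_ v
    filter_upwards [he] with q hq
    rw [hq]
  · simp only [map_add]
    rw [covAlong_add (h.diffAlongAt_apply hY) (h.diffAlongAt_apply hY'), ih, ih',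
      covAlong_add hY hY', map_add]
  · simp only [map_smul]
    rw [covAlong_smul hg (h.diffAlongAt_apply hY), ih, covAlong_smul hg hY, map_add, map_smul,
      map_smul]
  · rw [covAlong_comp hf hS, covAlong_comp hf (h.mdifferentiableAt_apply hS),
      h.parallel S (f p) hS]

end Kaehler

/-! ### Vanishing torsion along a map -/

section Torsion

variable {E : Type*} [NormedAddCommGroup E] [NormedSpace ℝ E] [FiniteDimensional ℝ E]
  {M : Type*} [TopologicalSpace M] [ChartedSpace E M] [IsManifold 𝓘(ℝ, E) ∞ M]
  {E' : Type*} [NormedAddCommGroup E'] [NormedSpace ℝ E'] [FiniteDimensional ℝ E']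
  {N : Type*} [TopologicalSpace N] [ChartedSpace E' N] [IsManifold 𝓘(ℝ, E') ∞ N]
  {nabla : CovariantDerivative 𝓘(ℝ, E') E' (fun x : N ↦ TangentSpace 𝓘(ℝ, E') x)}
  {f : M → N} {p : M} {X Y : ∀ p : M, TangentSpace 𝓘(ℝ, E) p}

/-- In the chart at `p` both extensions become constant fields, and constant fields commute. -/
theorem mlieBracket_extend (a b : TangentSpace 𝓘(ℝ, E) p) :
    VectorField.mlieBracket 𝓘(ℝ, E) (FiberBundle.extend E a) (FiberBundle.extend E b) p = 0 := by
  have key (c : TangentSpace 𝓘(ℝ, E) p) :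
      VectorField.mpullbackWithin 𝓘(ℝ, E) 𝓘(ℝ, E) (extChartAt 𝓘(ℝ, E) p).symm
        (FiberBundle.extend E c) (Set.range 𝓘(ℝ, E)) =ᶠ[𝓝 (extChartAt 𝓘(ℝ, E) p p)]
      fun _ ↦ (trivializationAt E (TangentSpace 𝓘(ℝ, E)) p ⟨p, c⟩).2 := by
    filter_upwards [extChartAt_target_mem_nhds (I := 𝓘(ℝ, E)) p] with y hy
    have hs : (extChartAt 𝓘(ℝ, E) p).symm y ∈ (chartAt E p).source := by
      have := (extChartAt 𝓘(ℝ, E) p).map_target hy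
      rwa [extChartAt_source] at this
    have h := TangentBundle.symmL_trivializationAt (I := 𝓘(ℝ, E)) hs
    rw [(extChartAt 𝓘(ℝ, E) p).right_inv hy] at h
    have hi := isInvertible_mfderivWithin_extChartAt_symm (I := 𝓘(ℝ, E)) hy
    refine hi.inverse_apply_eq.2 ?_
    rw [← h]
    exact ((trivializationAt E (TangentSpace 𝓘(ℝ, E)) p).symmL_apply hs _).symm
  rw [VectorField.mlieBracket, VectorField.mlieBracketWithin_apply]
  have h : VectorField.lieBracketWithin ℝ
      (VectorField.mpullbackWithin 𝓘(ℝ, E) 𝓘(ℝ, E) (extChartAt 𝓘(ℝ, E) p).symm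
        (FiberBundle.extend E a) (Set.range 𝓘(ℝ, E)))
      (VectorField.mpullbackWithin 𝓘(ℝ, E) 𝓘(ℝ, E) (extChartAt 𝓘(ℝ, E) p).symm
        (FiberBundle.extend E b) (Set.range 𝓘(ℝ, E)))
      ((extChartAt 𝓘(ℝ, E) p).symm ⁻¹' Set.univ ∩ Set.range 𝓘(ℝ, E))
      (extChartAt 𝓘(ℝ, E) p p) = 0 := by
    refine (((key a).filter_mono nhdsWithin_le_nhds).lieBracketWithin_vectorField_eq
      (key a).self_of_nhds ((key b).filter_mono nhdsWithin_le_nhds)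
      (key b).self_of_nhds).trans ?_
    simp [VectorField.lieBracketWithin]
  exact (congrArg _ h).trans (map_zero _)

theorem diffAlongAt_push (hf : ContMDiff 𝓘(ℝ, E) 𝓘(ℝ, E') ∞ f)
    (hX : MDifferentiableAt 𝓘(ℝ, E) (𝓘(ℝ, E).prod 𝓘(ℝ, E))
      (fun q ↦ (TotalSpace.mk' E q (X q) : TangentBundle 𝓘(ℝ, E) M)) p) :
    DiffAlongAt E E' f (fun q ↦ push f q (X q)) p := by
  have h : ContMDiff 𝓘(ℝ, E).tangent 𝓘(ℝ, E').tangent ∞ (tangentMap 𝓘(ℝ, E) 𝓘(ℝ, E') f) :=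
    hf.contMDiff_tangentMap (by simp)
  exact MDifferentiableAt.comp p
    ((h (TotalSpace.mk' E p (X p))).mdifferentiableAt (by simp)) hX

/-- With `F` the expression of `f` in charts, the coordinates of `df (extend a)` are `DF(y) a`.
Their derivative in direction `b` is `D²F(b, a)`, which is symmetric. -/
theorem mvfderiv_alongCoord_push_extend_comm (hf : ContMDiff 𝓘(ℝ, E) 𝓘(ℝ, E') ∞ f)
    (a b : TangentSpace 𝓘(ℝ, E) p) :
    mvfderiv 𝓘(ℝ, E) (alongCoord f p (fun q ↦ (push f q (FiberBundle.extend E a q) :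
        TangentSpace 𝓘(ℝ, E') (f q)))) p b
      = mvfderiv 𝓘(ℝ, E) (alongCoord f p (fun q ↦ (push f q (FiberBundle.extend E b q) :
        TangentSpace 𝓘(ℝ, E') (f q)))) p a := by
  let F : E → E' := extChartAt 𝓘(ℝ, E') (f p) ∘ f ∘ (extChartAt 𝓘(ℝ, E) p).symm
  let e := trivializationAt E (TangentSpace 𝓘(ℝ, E)) p
  have hF : ContDiffAt ℝ ∞ F (extChartAt 𝓘(ℝ, E) p p) := by
    have := (contMDiffAt_iff.1 (hf p)).2
    rwa [𝓘(ℝ, E).range_eq_univ, contDiffWithinAt_univ] at this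
  have key (c : TangentSpace 𝓘(ℝ, E) p) :
      alongCoord f p (fun q ↦ (push f q (FiberBundle.extend E c q) :
        TangentSpace 𝓘(ℝ, E') (f q)))
      =ᶠ[𝓝 p] (fun y ↦ fderiv ℝ F y (e ⟨p, c⟩).2) ∘ extChartAt 𝓘(ℝ, E) p := by
    filter_upwards [eventually_mem_baseSet ((hf p).mdifferentiableAt (by simp)),
      (chartAt E p).open_source.mem_nhds (mem_chart_source E p)] with q hq hqs
    have hqt : q ∈ (extChartAt 𝓘(ℝ, E) p).source := by rwa [extChartAt_source]
    obtain ⟨y, hy, rfl⟩ : ∃ y ∈ (extChartAt 𝓘(ℝ, E) p).target,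
        (extChartAt 𝓘(ℝ, E) p).symm y = q :=
      ⟨_, (extChartAt 𝓘(ℝ, E) p).map_source hqt, (extChartAt 𝓘(ℝ, E) p).left_inv hqt⟩
    rw [Function.comp_apply, (extChartAt 𝓘(ℝ, E) p).right_inv hy]
    -- The tangent trivializations are the derivatives of the charts, so the coordinates of `df`
    -- form a chain of three derivatives, whose composite is that of `F`.
    have h1 : HasMFDerivAt 𝓘(ℝ, E) 𝓘(ℝ, E) (extChartAt 𝓘(ℝ, E) p).symm y
        (e.symmL ℝ ((extChartAt 𝓘(ℝ, E) p).symm y)) := by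
      rw [TangentBundle.symmL_trivializationAt hqs, (extChartAt 𝓘(ℝ, E) p).right_inv hy]
      have h := (mdifferentiableWithinAt_extChartAt_symm hy).hasMFDerivWithinAt
      rw [𝓘(ℝ, E).range_eq_univ] at h ⊢
      exact hasMFDerivWithinAt_univ.1 h
    have h2 := ((hf ((extChartAt 𝓘(ℝ, E) p).symm y)).mdifferentiableAt (by simp)).hasMFDerivAt
    have h3 := (mdifferentiableAt_extChartAt (I := 𝓘(ℝ, E')) hq).hasMFDerivAt
    rw [← TangentBundle.continuousLinearMapAt_trivializationAt hq] at h3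
    have h4 : mfderiv 𝓘(ℝ, E) 𝓘(ℝ, E') F y = _ := (h3.comp y (h2.comp y h1)).mfderiv
    rw [mfderiv_eq_fderiv] at h4
    have h5 := DFunLike.congr_fun h4 (e ⟨p, c⟩).2
    refine ((Trivialization.continuousLinearMapAt_apply_of_mem (R := ℝ) _ hq _).symm).trans
      (Eq.trans ?_ h5.symm)
    exact congrArg (fun w ↦ (trivializationAt E' (TangentSpace 𝓘(ℝ, E')) (f p)).continuousLinearMapAt
      ℝ _ (mfderiv 𝓘(ℝ, E) 𝓘(ℝ, E') f _ w)) (e.symmL_apply (R := ℝ) hqs _).symm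
  have hψ : MDifferentiableAt 𝓘(ℝ, E) 𝓘(ℝ, E) (extChartAt 𝓘(ℝ, E) p) p :=
    mdifferentiableAt_extChartAt (mem_chart_source E p)
  have hd : DifferentiableAt ℝ (fderiv ℝ F) (extChartAt 𝓘(ℝ, E) p p) :=
    (hF.fderiv_right (m := ∞) (by simp)).differentiableAt (by simp)
  have hv (c : TangentSpace 𝓘(ℝ, E) p) :
      mfderiv 𝓘(ℝ, E) 𝓘(ℝ, E) (extChartAt 𝓘(ℝ, E) p) p c = (e ⟨p, c⟩).2 := by
    rw [← TangentBundle.continuousLinearMapAt_trivializationAt (mem_chart_source E p)]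
    exact e.continuousLinearMapAt_apply_of_mem (R := ℝ)
      (FiberBundle.mem_baseSet_trivializationAt' p) c
  have key2 (c d : TangentSpace 𝓘(ℝ, E) p) :
      mvfderiv 𝓘(ℝ, E) (alongCoord f p (fun q ↦ (push f q (FiberBundle.extend E c q) :
        TangentSpace 𝓘(ℝ, E') (f q)))) p d
      = fderiv ℝ (fderiv ℝ F) (extChartAt 𝓘(ℝ, E) p p) (e ⟨p, d⟩).2 (e ⟨p, c⟩).2 := by
    have h := mfderiv_comp_apply p
      (hd.clm_apply (differentiableAt_const (e ⟨p, c⟩).2)).mdifferentiableAt hψ d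
    rw [mfderiv_eq_fderiv, hv, fderiv_clm_apply hd (differentiableAt_const _)] at h
    rw [mvfderiv_congr (key c)]
    refine h.trans ?_
    simp
    rfl
  rw [key2, key2]
  exact (hF.isSymmSndFDerivAt (by simpa using ENat.LEInfty.out)).eq _ _

/-- A torsion-free connection is torsion-free along `f`. -/
theorem covAlong_push_sub_covAlong_push (hT : nabla.torsion = 0)
    (hf : ContMDiff 𝓘(ℝ, E) 𝓘(ℝ, E') ∞ f)
    (hX : MDifferentiableAt 𝓘(ℝ, E) (𝓘(ℝ, E).prod 𝓘(ℝ, E))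
      (fun q ↦ (TotalSpace.mk' E q (X q) : TangentBundle 𝓘(ℝ, E) M)) p)
    (hY : MDifferentiableAt 𝓘(ℝ, E) (𝓘(ℝ, E).prod 𝓘(ℝ, E))
      (fun q ↦ (TotalSpace.mk' E q (Y q) : TangentBundle 𝓘(ℝ, E) M)) p) :
    covAlong nabla f (fun q ↦ push f q (Y q)) p (X p)
        - covAlong nabla f (fun q ↦ push f q (X q)) p (Y p)
      = push f p (VectorField.mlieBracket 𝓘(ℝ, E) X Y p) := by
  have hfd : MDifferentiableAt 𝓘(ℝ, E) 𝓘(ℝ, E') f p := (hf p).mdifferentiableAt (by simp)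
  -- The defect `Φ` is antisymmetric and tensorial in each argument, so both fields may be replaced
  -- by extensions of their values at `p`, whose bracket vanishes.
  let Φ (X Y : ∀ p : M, TangentSpace 𝓘(ℝ, E) p) : TangentSpace 𝓘(ℝ, E') (f p) :=
    covAlong nabla f (fun q ↦ push f q (Y q)) p (X p)
        - covAlong nabla f (fun q ↦ push f q (X q)) p (Y p)
      - push f p (VectorField.mlieBracket 𝓘(ℝ, E) X Y p)
  have hanti (X Y : ∀ p : M, TangentSpace 𝓘(ℝ, E) p) : Φ X Y = - Φ Y X := by
    simp only [Φ]
    rw [VectorField.mlieBracket_swap_apply, map_neg]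
    abel
  have h1 (Y : ∀ p : M, TangentSpace 𝓘(ℝ, E) p) : TensorialAt 𝓘(ℝ, E) E (fun X ↦ Φ X Y) p := by
    refine ⟨fun {g X} hg hX ↦ ?_, fun {X X'} hX hX' ↦ ?_⟩
    · have h := covAlong_smul (nabla := nabla) hg (diffAlongAt_push hf hX) (Y p)
      simp only [Φ, Pi.smul_apply', map_smul]
      rw [h, VectorField.mlieBracket_smul_left hg hX]
      -- Unfolding exposes linearity in the direction; the derivative of `g` then cancels against
      -- the one from the bracket.
      simp only [covAlong_eq, map_add, map_smul, map_neg, neg_smul]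
      module
    · have h := covAlong_add (nabla := nabla) (diffAlongAt_push hf hX) (diffAlongAt_push hf hX')
        (Y p)
      simp only [Φ, Pi.add_apply, map_add]
      rw [h, VectorField.mlieBracket_add_left hX hX']
      simp only [covAlong_eq, map_add]
      abel
  have h2 (X : ∀ p : M, TangentSpace 𝓘(ℝ, E) p) : TensorialAt 𝓘(ℝ, E) E (Φ X) p := by
    refine ⟨fun {g Y} hg hY ↦ ?_, fun {Y Y'} hY hY' ↦ ?_⟩
    · rw [hanti, (h1 X).smul hg hY, hanti X, smul_neg]
    · rw [hanti, (h1 X).add hY hY', hanti X, hanti X, neg_add]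
  have h3 := TensorialAt.pointwise₂ (Φ := Φ) (fun Y _ ↦ h1 Y) (fun X _ ↦ h2 X) hX
    (FiberBundle.mdifferentiableAt_extend 𝓘(ℝ, E) E (X p)) hY
    (FiberBundle.mdifferentiableAt_extend 𝓘(ℝ, E) E (Y p))
    (FiberBundle.extend_apply_self E (X p)).symm (FiberBundle.extend_apply_self E (Y p)).symm
  refine sub_eq_zero.1 (h3.trans ?_)
  simp only [Φ]
  rw [mlieBracket_extend, map_zero, sub_zero, sub_eq_zero, covAlong_eq, covAlong_eq]
  simp only [FiberBundle.extend_apply_self]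
  rw [mvfderiv_alongCoord_push_extend_comm hf]
  congr 1
  -- What remains is the symmetry of the connection term, which is the vanishing of the torsion at
  -- `f p`.
  have h4 := nabla.torsion_apply_eq_extend (push f p (X p)) (push f p (Y p))
  rw [hT, mlieBracket_extend] at h4
  simp only [FiberBundle.extend_apply_self, sub_zero] at h4
  exact (sub_eq_zero.1 h4.symm)

end Torsion


theorem mdifferentiableAt_fun_sum {E : Type*} [NormedAddCommGroup E] [NormedSpace ℝ E]
    {M : Type*} [TopologicalSpace M] [ChartedSpace E M]
    {F : Type*} [NormedAddCommGroup F] [NormedSpace ℝ F]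
    {ι : Type} {t : Finset ι} {g : ι → M → F} {p : M}
    (hg : ∀ i ∈ t, MDifferentiableAt 𝓘(ℝ, E) 𝓘(ℝ, F) (g i) p) :
    MDifferentiableAt 𝓘(ℝ, E) 𝓘(ℝ, F) (fun q ↦ ∑ i ∈ t, g i q) p := by
  have h := MDifferentiableAt.sum hg
  simpa only [← Finset.sum_apply] using! h

/-- The `D'`-component of `w` is orthogonal to itself. -/
theorem mem_of_isCompl_of_inner_eq_zero {V : Type*} [NormedAddCommGroup V]
    [InnerProductSpace ℝ V] {D D' : Submodule ℝ V} (hc : IsCompl D D')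
    (ho : ∀ u ∈ D, ∀ v ∈ D', (inner ℝ u v : ℝ) = 0) {w : V}
    (hw : ∀ v ∈ D', (inner ℝ w v : ℝ) = 0) : w ∈ D := by
  obtain ⟨a, ha, b, hb, rfl⟩ := Submodule.mem_sup.1 (hc.sup_eq_top ▸ Submodule.mem_top : w ∈ D ⊔ D')
  have h := hw b hb
  rw [inner_add_left, ho a ha b hb, zero_add, inner_self_eq_zero] at h
  rwa [h, add_zero]

section Basic

variable {E : Type*} [NormedAddCommGroup E] [NormedSpace ℝ E]
  {M : Type*} [TopologicalSpace M] [ChartedSpace E M]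

theorem IsSmoothVectorField.mdifferentiableAt [IsManifold 𝓘(ℝ, E) ∞ M]
    {X : ∀ p : M, TangentSpace 𝓘(ℝ, E) p}
    (hX : IsSmoothVectorField X) (p : M) :
    MDifferentiableAt 𝓘(ℝ, E) (𝓘(ℝ, E).prod 𝓘(ℝ, E))
      (fun q ↦ (TotalSpace.mk' E q (X q) : TangentBundle 𝓘(ℝ, E) M)) p :=
  (hX p).mdifferentiableAt (by simp)

theorem inner_tan [FiniteDimensional ℝ E] [RiemannianBundle (fun p : M ↦ TangentSpace 𝓘(ℝ, E) p)]
    {E' : Type*} [NormedAddCommGroup E'] [NormedSpace ℝ E'] [FiniteDimensional ℝ E']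
    {N : Type*} [TopologicalSpace N] [ChartedSpace E' N]
    [RiemannianBundle (fun x : N ↦ TangentSpace 𝓘(ℝ, E') x)] {f : M → N} (p : M) (w : TangentSpace 𝓘(ℝ, E') (f p)) (v : TangentSpace 𝓘(ℝ, E) p) :
    inner ℝ (tan f p w) v = inner ℝ w (push f p v) :=
  LinearMap.adjoint_inner_left _ _ _

end Basic

/-! ### Differentiability of the tangential component -/

section Tangential

variable {E : Type*} [NormedAddCommGroup E] [NormedSpace ℝ E] [FiniteDimensional ℝ E]
  {M : Type*} [TopologicalSpace M] [ChartedSpace E M] [IsManifold 𝓘(ℝ, E) ∞ M]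
  [RiemannianBundle (fun p : M ↦ TangentSpace 𝓘(ℝ, E) p)]
  [IsContMDiffRiemannianBundle 𝓘(ℝ, E) ∞ E (fun p : M ↦ TangentSpace 𝓘(ℝ, E) p)]
  {p : M} {Z : ∀ p : M, TangentSpace 𝓘(ℝ, E) p}

/-- A vector field whose inner products with differentiable vector fields are differentiable is
differentiable. -/
theorem mdifferentiableAt_of_inner
    (h : ∀ X : ∀ p : M, TangentSpace 𝓘(ℝ, E) p,
      MDifferentiableAt 𝓘(ℝ, E) (𝓘(ℝ, E).prod 𝓘(ℝ, E))
        (fun q ↦ (TotalSpace.mk' E q (X q) : TangentBundle 𝓘(ℝ, E) M)) p →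
      MDifferentiableAt 𝓘(ℝ, E) 𝓘(ℝ) (fun q ↦ (inner ℝ (Z q) (X q) : ℝ)) p) :
    MDifferentiableAt 𝓘(ℝ, E) (𝓘(ℝ, E).prod 𝓘(ℝ, E))
      (fun q ↦ (TotalSpace.mk' E q (Z q) : TangentBundle 𝓘(ℝ, E) M)) p := by
  classical
  let e := trivializationAt E (TangentSpace 𝓘(ℝ, E)) p
  have hpe : p ∈ e.baseSet := FiberBundle.mem_baseSet_trivializationAt' p
  let b := Module.finBasis ℝ E
  let s (i) : ∀ q : M, TangentSpace 𝓘(ℝ, E) q :=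
    FiberBundle.extend E (e.symm p (b i) : TangentSpace 𝓘(ℝ, E) p)
  have hs (i) := FiberBundle.mdifferentiableAt_extend 𝓘(ℝ, E) E
    (e.symm p (b i) : TangentSpace 𝓘(ℝ, E) p)
  have hsb (i) (q : M) (hq : q ∈ e.baseSet) : s i q = e.symmL ℝ q (b i) := by
    rw [e.symmL_apply hq]
    change e.symm q (e ⟨p, e.symm p (b i)⟩).2 = e.symm q (b i)
    rw [e.apply_mk_symm hpe]
  let ι := Fin (Module.finrank ℝ E)
  let B (j i : ι) : (ι → ℝ) →L[ℝ] (ι → ℝ) :=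
    (ContinuousLinearMap.proj (R := ℝ) (φ := fun _ : ι ↦ ℝ) i).smulRight
      (Pi.single j (1 : ℝ) : ι → ℝ)
  -- The Gram matrix of the local frame `s`, acting on coefficient vectors; `B j i` is an elementary
  -- matrix.
  let L (q : M) : (ι → ℝ) →L[ℝ] (ι → ℝ) := ∑ j, ∑ i, (inner ℝ (s i q) (s j q) : ℝ) • B j i
  have hLapp (q : M) (c : ι → ℝ) (j : ι) :
      L q c j = inner ℝ (∑ i, c i • s i q) (s j q) := by
    simp only [L, B, sum_apply, smul_apply, ContinuousLinearMap.smulRight_apply,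
      Finset.sum_apply, Pi.smul_apply, Pi.single_apply, sum_inner, real_inner_smul_left,
      smul_eq_mul, ContinuousLinearMap.proj_apply]
    rw [Finset.sum_eq_single j (by intro k _ hk; simp [hk.symm]) (by simp)]
    exact Finset.sum_congr rfl fun i _ ↦ by simp; ring
  have hsum (q : M) (hq : q ∈ e.baseSet) (c : ι → ℝ) :
      ∑ i, c i • s i q = e.symmL ℝ q (b.equivFun.symm c) := by
    simp only [b.equivFun_symm_apply, map_sum, map_smul]
    exact Finset.sum_congr rfl fun i _ ↦ by rw [hsb i q hq]
  have hinv (q : M) (hq : q ∈ e.baseSet) : (L q).IsInvertible := by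
    have hinj : Function.Injective (L q).toLinearMap := by
      rw [← LinearMap.ker_eq_bot, LinearMap.ker_eq_bot']
      intro c hc
      -- Positive definiteness: the squared length of `∑ i, c i • s i q` is the pairing of `c` with
      -- `L q c`.
      have h0 : (inner ℝ (∑ i, c i • s i q) (∑ i, c i • s i q) : ℝ) = 0 := by
        conv_lhs => rw [inner_sum]
        refine Finset.sum_eq_zero fun j _ ↦ ?_
        rw [real_inner_smul_right, ← hLapp q c j]
        have : L q c = 0 := hc
        rw [this]; simp
      rw [inner_self_eq_zero, hsum q hq] at h0
      have h1 := congrArg (e.continuousLinearMapAt ℝ q) h0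
      rw [e.continuousLinearMapAt_symmL hq, map_zero] at h1
      exact b.equivFun.symm.map_eq_zero_iff.1 h1
    refine ⟨(LinearEquiv.ofInjectiveEndo _ hinj).toContinuousLinearEquiv, ?_⟩
    ext c : 1
    rfl
  have hLd : MDifferentiableAt 𝓘(ℝ, E) 𝓘(ℝ, (ι → ℝ) →L[ℝ] (ι → ℝ)) L p := by
    refine mdifferentiableAt_fun_sum fun j _ ↦ mdifferentiableAt_fun_sum fun i _ ↦ ?_
    exact (DiffAlongAt.inner (f := fun q : M ↦ q) (hs i) (hs j)).smul mdifferentiableAt_const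
  have hβ : MDifferentiableAt 𝓘(ℝ, E) 𝓘(ℝ, ι → ℝ)
      (fun q j ↦ (inner ℝ (Z q) (s j q) : ℝ)) p := by
    have h1 : (fun (q : M) (j : ι) ↦ (inner ℝ (Z q) (s j q) : ℝ))
        = fun q ↦ ∑ j, (inner ℝ (Z q) (s j q) : ℝ) • (Pi.single j (1 : ℝ) : ι → ℝ) := by
      funext q j
      simp [Finset.sum_apply, Pi.single_apply]
    rw [h1]
    exact mdifferentiableAt_fun_sum fun j _ ↦ (h _ (hs j)).smul mdifferentiableAt_const
  -- The coefficients of `Z` solve the Gram system, and inversion of operators is differentiable at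
  -- invertible ones.
  have hc : MDifferentiableAt 𝓘(ℝ, E) 𝓘(ℝ, ι → ℝ)
      (fun q ↦ (L q).inverse (fun j ↦ (inner ℝ (Z q) (s j q) : ℝ))) p := by
    obtain ⟨A, hA⟩ := hinv p hpe
    have h1 : DifferentiableAt ℝ ContinuousLinearMap.inverse (L p) := by
      rw [← hA]
      exact (contDiffAt_map_inverse (n := 1) A).differentiableAt (by simp)
    exact (h1.comp_mdifferentiableAt hLd).clm_apply hβ
  refine (mdifferentiableAt_totalSpace 𝓘(ℝ, E) _).2 ⟨mdifferentiableAt_id, ?_⟩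
  have hd := (b.equivFun.symm.toContinuousLinearEquiv.differentiableAt).comp_mdifferentiableAt hc
  refine hd.congr_of_eventuallyEq ?_
  filter_upwards [e.open_baseSet.mem_nhds hpe] with q hq
  change (e ⟨q, Z q⟩).2 = b.equivFun.symm _
  rw [LinearEquiv.eq_symm_apply, eq_comm]
  refine (hinv q hq).inverse_apply_eq.2 ?_
  funext j
  rw [hLapp, hsum q hq, LinearEquiv.symm_apply_apply, e.symmL_apply hq,
    e.symm_apply_apply_mk hq]

variable {E' : Type*} [NormedAddCommGroup E'] [NormedSpace ℝ E'] [FiniteDimensional ℝ E']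
  {N : Type*} [TopologicalSpace N] [ChartedSpace E' N] [IsManifold 𝓘(ℝ, E') ∞ N]
  [RiemannianBundle (fun x : N ↦ TangentSpace 𝓘(ℝ, E') x)]
  [IsContMDiffRiemannianBundle 𝓘(ℝ, E') ∞ E' (fun x : N ↦ TangentSpace 𝓘(ℝ, E') x)]
  {f : M → N}

/-- As `tan` is the adjoint of `df`, the products g(tan Y, X) = g(Y, df X) are differentiable for
each differentiable X, which is enough. -/
theorem DiffAlongAt.mdifferentiableAt_tan (hf : ContMDiff 𝓘(ℝ, E) 𝓘(ℝ, E') ∞ f)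
    {Y : ∀ p : M, TangentSpace 𝓘(ℝ, E') (f p)} (hY : DiffAlongAt E E' f Y p) :
    MDifferentiableAt 𝓘(ℝ, E) (𝓘(ℝ, E).prod 𝓘(ℝ, E))
      (fun q ↦ (TotalSpace.mk' E q (tan f q (Y q)) : TangentBundle 𝓘(ℝ, E) M)) p := by
  refine mdifferentiableAt_of_inner fun X hX ↦ ?_
  simp only [inner_tan]
  exact hY.inner (diffAlongAt_push hf hX)

end Tangential

/-! ### Global sections and a test for integrability -/

section Sections

variable {E : Type*} [NormedAddCommGroup E] [NormedSpace ℝ E] [FiniteDimensional ℝ E]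
  {M : Type*} [TopologicalSpace M] [T2Space M] [ChartedSpace E M] [IsManifold 𝓘(ℝ, E) ∞ M]

/-- Every vector of a smooth distribution extends to a global section. -/
theorem IsSmoothDistribution.exists_section {k : ℕ}
    {D : ∀ p : M, Submodule ℝ (TangentSpace 𝓘(ℝ, E) p)} (hD : IsSmoothDistribution k D)
    {p : M} {v : TangentSpace 𝓘(ℝ, E) p} (hv : v ∈ D p) :
    ∃ V : ∀ p : M, TangentSpace 𝓘(ℝ, E) p, IsSection D V ∧ V p = v := by
  obtain ⟨U, hU, hpU, X, hX, hspan⟩ := hD.local_frame p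
  rw [hspan p hpU, Submodule.mem_span_range_iff_exists_fun] at hv
  obtain ⟨c, rfl⟩ := hv
  -- A bump function equal to 1 at `p` and supported in `U` makes a local combination of the frame
  -- global.
  obtain ⟨ψ, -, hψ⟩ := (SmoothBumpFunction.nhds_basis_tsupport (I := 𝓘(ℝ, E)) p).mem_iff.1
    (hU.mem_nhds hpU)
  refine ⟨fun q ↦ ψ q • ∑ i, c i • X i q, ⟨?_, fun q ↦ ?_⟩, by simp⟩
  · refine ContMDiffOn.smul_section_of_tsupport (ψ.contMDiff.contMDiffOn) hU hψ ?_
    exact ContMDiffOn.sum_section fun i _ ↦ contMDiffOn_const.smul_section (hX i)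
  · by_cases hq : q ∈ U
    · rw [hspan q hq]
      exact Submodule.smul_mem _ _ (Submodule.sum_mem _ fun i _ ↦
        Submodule.smul_mem _ _ (Submodule.subset_span ⟨i, rfl⟩))
    · have : ψ q = 0 := by
        by_contra h
        exact hq (hψ (subset_tsupport _ h))
      simp [this]

variable [RiemannianBundle (fun p : M ↦ TangentSpace 𝓘(ℝ, E) p)]
  [IsContMDiffRiemannianBundle 𝓘(ℝ, E) ∞ E (fun p : M ↦ TangentSpace 𝓘(ℝ, E) p)]

/-- Integrability of a distribution can be tested against sections of its orthogonal complement,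
on a dense set of points. -/
theorem isIntegrable_iff_of_dense {D D' : ∀ p : M, Submodule ℝ (TangentSpace 𝓘(ℝ, E) p)} {k : ℕ}
    (hD' : IsSmoothDistribution k D') (hc : ∀ p, IsCompl (D p) (D' p))
    (ho : ∀ p, ∀ u ∈ D p, ∀ v ∈ D' p, (inner ℝ u v : ℝ) = 0)
    {c : M → ℝ} (hdense : Dense {p | c p ≠ 0}) :
    IsIntegrable D ↔ ∀ X Y Z : ∀ p : M, TangentSpace 𝓘(ℝ, E) p,
      IsSection D X → IsSection D Y → IsSection D' Z → ∀ p,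
        c p * inner ℝ (VectorField.mlieBracket 𝓘(ℝ, E) X Y p) (Z p) = 0 := by
  refine ⟨fun h X Y Z hX hY hZ p ↦ by rw [ho p _ (h X Y hX hY p) _ (hZ.2 p), mul_zero],
    fun h X Y hX hY p ↦ mem_of_isCompl_of_inner_eq_zero (hc p) (ho p) fun v hv ↦ ?_⟩
  obtain ⟨Z, hZ, rfl⟩ := hD'.exists_section hv
  have hb (q : M) : MDifferentiableAt 𝓘(ℝ, E) (𝓘(ℝ, E).prod 𝓘(ℝ, E)) (fun q ↦
      (TotalSpace.mk' E q (VectorField.mlieBracket 𝓘(ℝ, E) X Y q) : TangentBundle 𝓘(ℝ, E) M)) q := by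
    have : IsManifold 𝓘(ℝ, E) (minSmoothness ℝ 2) M := by
      rw [minSmoothness_of_isRCLikeNormedField]
      infer_instance
    have : IsManifold 𝓘(ℝ, E) (((⊤ : ℕ∞) : WithTop ℕ∞) + 1) M := inferInstanceAs (IsManifold _ ∞ M)
    -- Class C¹ suffices, since only the continuity of the inner product below is needed.
    exact (ContMDiffAt.mlieBracket_vectorField (m := 1) (n := ⊤) (hX.1 q) (hY.1 q)
      (by rw [minSmoothness_of_isRCLikeNormedField]; exact_mod_cast le_top)).mdifferentiableAt (by simp)
  have hcont : Continuous fun q ↦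
      (inner ℝ (VectorField.mlieBracket 𝓘(ℝ, E) X Y q) (Z q) : ℝ) :=
    continuous_iff_continuousAt.2 fun q ↦
      (DiffAlongAt.inner (f := fun q : M ↦ q) (hb q) (hZ.1.mdifferentiableAt q)).continuousAt
  have heq := hcont.ext_on hdense continuous_const (g := fun _ ↦ (0 : ℝ)) fun q hq ↦
    (mul_eq_zero.1 (h X Y Z hX hY hZ q)).resolve_left hq
  exact congrFun heq p

end Sections


/-! ### Linear algebra of T and F at a point -/

section Pointwise

variable {E' : Type*} [NormedAddCommGroup E'] [NormedSpace ℝ E'] [FiniteDimensional ℝ E']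
  {N : Type*} [TopologicalSpace N] [ChartedSpace E' N]
  [RiemannianBundle (fun x : N ↦ TangentSpace 𝓘(ℝ, E') x)]
  {J : ∀ x : N, TangentSpace 𝓘(ℝ, E') x →L[ℝ] TangentSpace 𝓘(ℝ, E') x}
  {E : Type*} [NormedAddCommGroup E] [NormedSpace ℝ E] [FiniteDimensional ℝ E]
  {M : Type*} [TopologicalSpace M] [ChartedSpace E M]
  [RiemannianBundle (fun p : M ↦ TangentSpace 𝓘(ℝ, E) p)]
  {f : M → N} {p : M}

variable (E J f p) in
/-- The tangential part of `J`, as an endomorphism of the tangent space of `M` at `p`. -/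
def tanJ : TangentSpace 𝓘(ℝ, E) p →ₗ[ℝ] TangentSpace 𝓘(ℝ, E) p :=
  LinearMap.adjoint (push f p) ∘ₗ (J (f p)).toLinearMap ∘ₗ push f p

theorem tanJ_apply (v : TangentSpace 𝓘(ℝ, E) p) :
    tanJ J E f p v = tan f p (J (f p) (push f p v)) := rfl

theorem inner_tanJ (v w : TangentSpace 𝓘(ℝ, E) p) :
    (inner ℝ (tanJ J E f p v) w : ℝ) = inner ℝ (J (f p) (push f p v)) (push f p w) := by
  rw [tanJ_apply, inner_tan]

theorem nor_apply_push (v : TangentSpace 𝓘(ℝ, E) p) :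
    nor E f p (J (f p) (push f p v)) = J (f p) (push f p v) - push f p (tanJ J E f p v) := rfl

theorem inner_nor_nor (hf : IsIsometricImmersion E E' f) (w w' : TangentSpace 𝓘(ℝ, E') (f p)) :
    (inner ℝ (nor E f p w) (nor E f p w') : ℝ) = inner ℝ w (nor E f p w') := by
  conv_lhs => rw [nor, inner_sub_left]
  rw [real_inner_comm (nor E f p w') (push f p (tan f p w)), inner_nor_push hf, sub_zero]

variable [IsManifold 𝓘(ℝ, E) ∞ M]
  {DT Dθ : ∀ p : M, Submodule ℝ (TangentSpace 𝓘(ℝ, E) p)} {m₁ m₂ : ℕ} {θ : M → ℝ}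

/-- J maps `df (DT p)` into itself, and `tan` inverts `df` on tangent vectors; so T is J on DT. -/
theorem IsPointwiseSemiSlant.push_tanJ (hM : IsPointwiseSemiSlant J f DT Dθ m₁ m₂ θ)
    (hf : IsIsometricImmersion E E' f) {v : TangentSpace 𝓘(ℝ, E) p} (hv : v ∈ DT p) :
    tanJ J E f p v ∈ DT p ∧ push f p (tanJ J E f p v) = J (f p) (push f p v) := by
  have h : J (f p) (push f p v) ∈ (DT p).map (push f p) := by
    rw [← hM.holomorphic p]
    exact Submodule.mem_map_of_mem (Submodule.mem_map_of_mem hv)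
  obtain ⟨u, hu, huv⟩ := h
  have : tanJ J E f p v = u := by
    rw [← tan_push hf p u, huv]
    rfl
  rw [this]
  exact ⟨hu, huv⟩

variable [IsManifold 𝓘(ℝ, E') ∞ N]
  {nabla : CovariantDerivative 𝓘(ℝ, E') E' (fun x : N ↦ TangentSpace 𝓘(ℝ, E') x)}

theorem IsKaehler.inner_apply_left (hN : IsKaehler J nabla) {x : N}
    (v w : TangentSpace 𝓘(ℝ, E') x) :
    (inner ℝ (J x v) w : ℝ) = -inner ℝ v (J x w) := by
  rw [← hN.inner_map x v (J x w), hN.sq, inner_neg_right, neg_neg]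

theorem IsKaehler.inner_tanJ_left (hN : IsKaehler J nabla) (v w : TangentSpace 𝓘(ℝ, E) p) :
    (inner ℝ (tanJ J E f p v) w : ℝ) = -inner ℝ v (tanJ J E f p w) := by
  rw [inner_tanJ, hN.inner_apply_left, real_inner_comm, ← inner_tanJ, real_inner_comm]

/-- T is skew and preserves DT, hence preserves its orthogonal complement. -/
theorem IsPointwiseSemiSlant.tanJ_mem (hM : IsPointwiseSemiSlant J f DT Dθ m₁ m₂ θ)
    (hN : IsKaehler J nabla) (hf : IsIsometricImmersion E E' f) {v : TangentSpace 𝓘(ℝ, E) p}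
    (hv : v ∈ Dθ p) : tanJ J E f p v ∈ Dθ p := by
  refine mem_of_isCompl_of_inner_eq_zero (hM.isCompl p).symm
    (fun u hu w hw ↦ by rw [real_inner_comm, hM.orthogonal p w hw u hu]) fun u hu ↦ ?_
  rw [hN.inner_tanJ_left, real_inner_comm, hM.orthogonal p _ (hM.push_tanJ hf hu).1 v hv, neg_zero]

/-- As Tv lies in Dθ, the projection of Jv to Dθ is Tv. The slant angle is thus the one between Jv
and Tv, and |Jv| = |v|. -/
theorem IsPointwiseSemiSlant.inner_tanJ_self (hM : IsPointwiseSemiSlant J f DT Dθ m₁ m₂ θ)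
    (hN : IsKaehler J nabla) (hf : IsIsometricImmersion E E' f) {v : TangentSpace 𝓘(ℝ, E) p}
    (hv : v ∈ Dθ p) :
    (inner ℝ (tanJ J E f p v) (tanJ J E f p v) : ℝ) = Real.cos (θ p) ^ 2 * inner ℝ v v := by
  rcases eq_or_ne v 0 with rfl | hv0
  · simp
  have hproj : ((Dθ p).map (push f p)).starProjection (J (f p) (push f p v))
      = push f p (tanJ J E f p v) := by
    refine Submodule.eq_starProjection_of_mem_of_inner_eq_zero
      (Submodule.mem_map_of_mem (hM.tanJ_mem hN hf hv)) ?_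
    rintro _ ⟨w, -, rfl⟩
    exact inner_nor_push hf p _ w
  have hθ := hM.slant p v hv hv0
  rw [angleWithSubspace, hproj] at hθ
  have hc := InnerProductGeometry.cos_angle_mul_norm_mul_norm (J (f p) (push f p v))
    (push f p (tanJ J E f p v))
  rw [hθ, ← inner_tanJ] at hc
  have h1 : ‖J (f p) (push f p v)‖ = ‖v‖ := by
    rw [norm_eq_sqrt_real_inner, norm_eq_sqrt_real_inner, hN.inner_map]
    exact congrArg _ (hf.inner_map p v v)
  have h2 (u : TangentSpace 𝓘(ℝ, E) p) : ‖(push f p u : TangentSpace 𝓘(ℝ, E') (f p))‖ = ‖u‖ := by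
    rw [norm_eq_sqrt_real_inner, norm_eq_sqrt_real_inner]
    exact congrArg _ (hf.inner_map p u u)
  rw [h1, h2, real_inner_self_eq_norm_sq] at hc
  rw [real_inner_self_eq_norm_sq, real_inner_self_eq_norm_sq]
  -- The cosine formula carries a factor |Tv| that must be cancelled. If Tv = 0, the angle with the
  -- zero vector is π/2 by convention, and both sides vanish.
  rcases eq_or_ne (tanJ J E f p v) 0 with h0 | h0
  · rw [h0, map_zero, InnerProductGeometry.angle_zero_right] at hθ
    rw [h0, ← hθ]
    simp
  · have h3 : ‖tanJ J E f p v‖ ≠ 0 := norm_ne_zero_iff.2 h0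
    have h4 : Real.cos (θ p) * ‖v‖ = ‖tanJ J E f p v‖ :=
      mul_right_cancel₀ h3 (by rw [mul_assoc, hc, sq])
    rw [← h4, mul_pow]

/-- On the slant distribution, the square of the tangential part of `J` is `-cos² θ`. -/
theorem IsPointwiseSemiSlant.tanJ_tanJ (hM : IsPointwiseSemiSlant J f DT Dθ m₁ m₂ θ)
    (hN : IsKaehler J nabla) (hf : IsIsometricImmersion E E' f) {v : TangentSpace 𝓘(ℝ, E) p}
    (hv : v ∈ Dθ p) :
    tanJ J E f p (tanJ J E f p v) = -(Real.cos (θ p) ^ 2 • v) := by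
  -- Polarization of `inner_tanJ_self`. The vector T²v + cos²θ v then turns out to be orthogonal to
  -- itself.
  have hpol (w : TangentSpace 𝓘(ℝ, E) p) (hw : w ∈ Dθ p) :
      (inner ℝ (tanJ J E f p v) (tanJ J E f p w) : ℝ) = Real.cos (θ p) ^ 2 * inner ℝ v w := by
    have h1 := hM.inner_tanJ_self hN hf hv
    have h2 := hM.inner_tanJ_self hN hf hw
    have h3 := hM.inner_tanJ_self hN hf (add_mem hv hw)
    rw [map_add, real_inner_add_add_self, real_inner_add_add_self] at h3
    linarith
  have hmem : tanJ J E f p (tanJ J E f p v) + Real.cos (θ p) ^ 2 • v ∈ Dθ p :=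
    add_mem (hM.tanJ_mem hN hf (hM.tanJ_mem hN hf hv)) (Submodule.smul_mem _ _ hv)
  rw [eq_neg_iff_add_eq_zero, ← inner_self_eq_zero (𝕜 := ℝ)]
  conv_lhs => rw [inner_add_left]
  rw [hN.inner_tanJ_left, hpol _ hmem, real_inner_smul_left, neg_add_cancel]

/-- From g(w, v) = g(Jw, Tv) + g(Jw, Fv) and g(Jw, Tv) = -g(w, JTv) = cos²θ g(w, v) - g(w, FTv). -/
theorem IsPointwiseSemiSlant.sin_sq_mul_inner (hM : IsPointwiseSemiSlant J f DT Dθ m₁ m₂ θ)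
    (hN : IsKaehler J nabla) (hf : IsIsometricImmersion E E' f)
    (w : TangentSpace 𝓘(ℝ, E') (f p)) {v : TangentSpace 𝓘(ℝ, E) p} (hv : v ∈ Dθ p) :
    Real.sin (θ p) ^ 2 * inner ℝ w (push f p v)
      = inner ℝ (J (f p) w) (nor E f p (J (f p) (push f p v)))
        - inner ℝ w (nor E f p (J (f p) (push f p (tanJ J E f p v)))) := by
  rw [nor_apply_push, nor_apply_push, hM.tanJ_tanJ hN hf hv, inner_sub_right, inner_sub_right,
    hN.inner_map, hN.inner_apply_left, map_neg, map_smul, inner_neg_right, real_inner_smul_right,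
    Real.sin_sq]
  ring

end Pointwise

/-! ### Weingarten relation and the two bracket identities -/

section Fields

variable {E' : Type*} [NormedAddCommGroup E'] [NormedSpace ℝ E'] [FiniteDimensional ℝ E']
  {N : Type*} [TopologicalSpace N] [ChartedSpace E' N] [IsManifold 𝓘(ℝ, E') ∞ N]
  [RiemannianBundle (fun x : N ↦ TangentSpace 𝓘(ℝ, E') x)]
  [IsContMDiffRiemannianBundle 𝓘(ℝ, E') ∞ E' (fun x : N ↦ TangentSpace 𝓘(ℝ, E') x)]
  {J : ∀ x : N, TangentSpace 𝓘(ℝ, E') x →L[ℝ] TangentSpace 𝓘(ℝ, E') x}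
  {nabla : CovariantDerivative 𝓘(ℝ, E') E' (fun x : N ↦ TangentSpace 𝓘(ℝ, E') x)}
  {E : Type*} [NormedAddCommGroup E] [NormedSpace ℝ E] [FiniteDimensional ℝ E]
  {M : Type*} [TopologicalSpace M] [ChartedSpace E M] [IsManifold 𝓘(ℝ, E) ∞ M]
  [RiemannianBundle (fun p : M ↦ TangentSpace 𝓘(ℝ, E) p)]
  {f : M → N} {p : M}

/-- The Weingarten relation between the shape operator and the second fundamental form. -/
theorem IsLeviCivita.inner_shape (h : IsLeviCivita nabla) (hf : IsIsometricImmersion E E' f)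
    {ξ : ∀ p : M, TangentSpace 𝓘(ℝ, E') (f p)} (hξ : DiffAlongAt E E' f ξ p)
    {X : ∀ p : M, TangentSpace 𝓘(ℝ, E) p}
    (hX : MDifferentiableAt 𝓘(ℝ, E) (𝓘(ℝ, E).prod 𝓘(ℝ, E))
      (fun q ↦ (TotalSpace.mk' E q (X q) : TangentBundle 𝓘(ℝ, E) M)) p)
    (ho : ∀ q, (inner ℝ (ξ q) (push f q (X q)) : ℝ) = 0) (V : ∀ p : M, TangentSpace 𝓘(ℝ, E) p) :
    (inner ℝ (shape nabla f ξ V p) (X p) : ℝ)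
      = inner ℝ (covAlong nabla f (fun q ↦ push f q (X q)) p (V p)) (ξ p) := by
  -- The function g(ξ, X) vanishes identically, so the two terms of its derivative are opposite.
  have h1 := h.mvfderiv_inner hξ (diffAlongAt_push hf.smooth hX) (V p)
  rw [funext ho, mvfderiv_const, zero_apply] at h1
  rw [shape, inner_neg_left, inner_tan,
    real_inner_comm (ξ p) (covAlong nabla f (fun q ↦ push f q (X q)) p (V p))]
  linarith

variable {DT Dθ : ∀ p : M, Submodule ℝ (TangentSpace 𝓘(ℝ, E) p)} {m₁ m₂ : ℕ} {θ : M → ℝ}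
  {X Y V W : ∀ p : M, TangentSpace 𝓘(ℝ, E) p}

theorem IsPointwiseSemiSlant.covAlong_push_opT (hM : IsPointwiseSemiSlant J f DT Dθ m₁ m₂ θ)
    (hN : IsKaehler J nabla) (hf : IsIsometricImmersion E E' f) (hX : IsSection DT X)
    (v : TangentSpace 𝓘(ℝ, E) p) :
    covAlong nabla f (fun q ↦ push f q (opT J f X q)) p v
      = J (f p) (covAlong nabla f (fun q ↦ push f q (X q)) p v) := by
  rw [← hN.covAlong_apply (diffAlongAt_push hf.smooth (hX.1.mdifferentiableAt p))]
  have h : (fun q ↦ (push f q (opT J f X q) : TangentSpace 𝓘(ℝ, E') (f q)))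
      = fun q ↦ J (f q) (push f q (X q)) :=
    funext fun q ↦ (hM.push_tanJ hf (hX.2 q)).2
  rw [h]

variable [IsContMDiffRiemannianBundle 𝓘(ℝ, E) ∞ E (fun p : M ↦ TangentSpace 𝓘(ℝ, E) p)]

theorem IsKaehler.mdifferentiableAt_opT (hN : IsKaehler J nabla)
    (hf : IsIsometricImmersion E E' f) {X : ∀ p : M, TangentSpace 𝓘(ℝ, E) p}
    (hX : MDifferentiableAt 𝓘(ℝ, E) (𝓘(ℝ, E).prod 𝓘(ℝ, E))
      (fun q ↦ (TotalSpace.mk' E q (X q) : TangentBundle 𝓘(ℝ, E) M)) p) :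
    MDifferentiableAt 𝓘(ℝ, E) (𝓘(ℝ, E).prod 𝓘(ℝ, E))
      (fun q ↦ (TotalSpace.mk' E q (opT J f X q) : TangentBundle 𝓘(ℝ, E) M)) p :=
  (hN.diffAlongAt_apply (diffAlongAt_push hf.smooth hX)).mdifferentiableAt_tan hf.smooth

theorem IsKaehler.diffAlongAt_opF (hN : IsKaehler J nabla)
    (hf : IsIsometricImmersion E E' f) {X : ∀ p : M, TangentSpace 𝓘(ℝ, E) p}
    (hX : MDifferentiableAt 𝓘(ℝ, E) (𝓘(ℝ, E).prod 𝓘(ℝ, E))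
      (fun q ↦ (TotalSpace.mk' E q (X q) : TangentBundle 𝓘(ℝ, E) M)) p) :
    DiffAlongAt E E' f (opF J f X) p :=
  (hN.diffAlongAt_apply (diffAlongAt_push hf.smooth hX)).sub
    (diffAlongAt_push hf.smooth (hN.mdifferentiableAt_opT hf hX))

/-- The pointwise identity for w = [X, Y]. Swapping ∇_Y JX for ∇_{JX} Y costs the tangent vector
[JX, Y], invisible to the normal vector FV. -/
theorem IsPointwiseSemiSlant.sin_sq_mul_inner_mlieBracket_holomorphic
    (hM : IsPointwiseSemiSlant J f DT Dθ m₁ m₂ θ) (hN : IsKaehler J nabla)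
    (hf : IsIsometricImmersion E E' f) (hX : IsSection DT X) (hY : IsSection DT Y)
    (hV : V p ∈ Dθ p) :
    Real.sin (θ p) ^ 2 * inner ℝ (VectorField.mlieBracket 𝓘(ℝ, E) X Y p) (V p)
      = inner ℝ (secondForm nabla f X (opT J f Y) p) (opF J f V p)
        - inner ℝ (secondForm nabla f (opT J f X) Y p) (opF J f V p) := by
  have hXd := hX.1.mdifferentiableAt p
  have hYd := hY.1.mdifferentiableAt p
  have hT := hN.leviCivita.torsion_eq_zero
  have hn (u : TangentSpace 𝓘(ℝ, E) p) (w : TangentSpace 𝓘(ℝ, E') (f p)) :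
      (inner ℝ (push f p u) (nor E f p w) : ℝ) = 0 := by
    rw [real_inner_comm, inner_nor_push hf]
  have h1 := hM.sin_sq_mul_inner hN hf (push f p (VectorField.mlieBracket 𝓘(ℝ, E) X Y p)) hV
  rw [hn, sub_zero, ← covAlong_push_sub_covAlong_push hT hf.smooth hXd hYd, map_sub,
    ← hM.covAlong_push_opT hN hf hY, ← hM.covAlong_push_opT hN hf hX,
    covAlong_push_sub_covAlong_push hT hf.smooth hXd hYd] at h1
  have h2 := covAlong_push_sub_covAlong_push hT hf.smooth (hN.mdifferentiableAt_opT hf hXd) hYd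
  rw [sub_eq_iff_eq_add', ← sub_eq_iff_eq_add] at h2
  have h3 : (inner ℝ (push f p (VectorField.mlieBracket 𝓘(ℝ, E) X Y p)) (push f p (V p)) : ℝ)
      = inner ℝ (VectorField.mlieBracket 𝓘(ℝ, E) X Y p) (V p) := hf.inner_map p _ _
  rw [← h3, h1, ← h2, inner_sub_left, inner_sub_left, hn, sub_zero]
  simp only [secondForm, opF, inner_nor_nor hf]

/-- The pointwise identity for w = ∇_V X, where Jw = ∇_V JX; the Weingarten relation rewrites both
terms. -/
theorem IsPointwiseSemiSlant.sin_sq_mul_inner_covAlong_push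
    (hM : IsPointwiseSemiSlant J f DT Dθ m₁ m₂ θ) (hN : IsKaehler J nabla)
    (hf : IsIsometricImmersion E E' f) (hX : IsSection DT X) (hW : IsSection Dθ W) :
    Real.sin (θ p) ^ 2 * inner ℝ (covAlong nabla f (fun q ↦ push f q (X q)) p (V p))
        (push f p (W p))
      = inner ℝ (shape nabla f (opF J f W) V p) (opT J f X p)
        - inner ℝ (shape nabla f (opF J f (opT J f W)) V p) (X p) := by
  have hXd := hX.1.mdifferentiableAt p
  have hWd := hW.1.mdifferentiableAt p
  rw [hM.sin_sq_mul_inner hN hf _ (hW.2 p), ← hM.covAlong_push_opT hN hf hX,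
    hN.leviCivita.inner_shape hf (hN.diffAlongAt_opF hf hWd) (hN.mdifferentiableAt_opT hf hXd)
      (fun q ↦ inner_nor_push hf q _ _),
    hN.leviCivita.inner_shape hf (hN.diffAlongAt_opF hf (hN.mdifferentiableAt_opT hf hWd)) hXd
      (fun q ↦ inner_nor_push hf q _ _)]
  rfl

theorem IsPointwiseSemiSlant.sin_sq_mul_inner_mlieBracket_slant
    (hM : IsPointwiseSemiSlant J f DT Dθ m₁ m₂ θ) (hN : IsKaehler J nabla)
    (hf : IsIsometricImmersion E E' f) (hV : IsSection Dθ V) (hW : IsSection Dθ W)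
    (hX : IsSection DT X) :
    Real.sin (θ p) ^ 2 * inner ℝ (VectorField.mlieBracket 𝓘(ℝ, E) V W p) (X p)
      = inner ℝ (shape nabla f (opF J f (opT J f W)) V p
          - shape nabla f (opF J f (opT J f V)) W p) (X p)
        - inner ℝ (shape nabla f (opF J f W) V p - shape nabla f (opF J f V) W p)
          (opT J f X p) := by
  have hXd := diffAlongAt_push hf.smooth (hX.1.mdifferentiableAt p)
  -- W and X are orthogonal everywhere, so differentiating g(W, X) = 0 moves the derivative from W
  -- to X.
  have hcov {V W : ∀ p : M, TangentSpace 𝓘(ℝ, E) p} (hW : IsSection Dθ W) :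
      (inner ℝ (covAlong nabla f (fun q ↦ push f q (W q)) p (V p)) (push f p (X p)) : ℝ)
      = -inner ℝ (covAlong nabla f (fun q ↦ push f q (X q)) p (V p)) (push f p (W p)) := by
    have h := hN.leviCivita.mvfderiv_inner
      (diffAlongAt_push hf.smooth (hW.1.mdifferentiableAt p)) hXd (V p)
    have h0 (q : M) : (inner ℝ (push f q (W q) : TangentSpace 𝓘(ℝ, E') (f q)) (push f q (X q)) : ℝ) = 0 := by
      rw [real_inner_comm]
      exact (hf.inner_map q _ _).trans (hM.orthogonal q _ (hX.2 q) _ (hW.2 q))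
    rw [funext h0, mvfderiv_const, zero_apply] at h
    rw [real_inner_comm (push f p (W p))
      (covAlong nabla f (fun q ↦ push f q (X q)) p (V p))]
    linarith
  have h3 : (inner ℝ (push f p (VectorField.mlieBracket 𝓘(ℝ, E) V W p)) (push f p (X p)) : ℝ)
      = inner ℝ (VectorField.mlieBracket 𝓘(ℝ, E) V W p) (X p) := hf.inner_map p _ _
  rw [← h3, ← covAlong_push_sub_covAlong_push hN.leviCivita.torsion_eq_zero hf.smooth
      (hV.1.mdifferentiableAt p) (hW.1.mdifferentiableAt p), inner_sub_left, hcov hW, hcov hV,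
    mul_sub, mul_neg, mul_neg, hM.sin_sq_mul_inner_covAlong_push hN hf hX hW,
    hM.sin_sq_mul_inner_covAlong_push hN hf hX hV, inner_sub_left, inner_sub_left]
  ring

end Fields

end SemiSlant
end

theorem theorem3p3
    -- the ambient manifold `N` with its Riemannian metric
    {E' : Type*} [NormedAddCommGroup E'] [NormedSpace ℝ E'] [FiniteDimensional ℝ E']
    {N : Type*} [TopologicalSpace N] [T2Space N] [ChartedSpace E' N] [IsManifold 𝓘(ℝ, E') ∞ N]
    [RiemannianBundle (fun x : N ↦ TangentSpace 𝓘(ℝ, E') x)]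
    [IsContMDiffRiemannianBundle 𝓘(ℝ, E') ∞ E' (fun x : N ↦ TangentSpace 𝓘(ℝ, E') x)]
    -- the manifold `M` with its Riemannian metric
    {E : Type*} [NormedAddCommGroup E] [NormedSpace ℝ E] [FiniteDimensional ℝ E]
    {M : Type*} [TopologicalSpace M] [T2Space M] [ChartedSpace E M] [IsManifold 𝓘(ℝ, E) ∞ M]
    [RiemannianBundle (fun p : M ↦ TangentSpace 𝓘(ℝ, E) p)]
    [IsContMDiffRiemannianBundle 𝓘(ℝ, E) ∞ E (fun p : M ↦ TangentSpace 𝓘(ℝ, E) p)]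
    -- the Kaehler structure of `N`
    (J : ∀ x : N, TangentSpace 𝓘(ℝ, E') x →L[ℝ] TangentSpace 𝓘(ℝ, E') x)
    (nabla : CovariantDerivative 𝓘(ℝ, E') E' (fun x : N ↦ TangentSpace 𝓘(ℝ, E') x))
    (hN : SemiSlant.IsKaehler J nabla)
    -- `M` is a proper pointwise semi-slant submanifold of `N`
    (f : M → N) (hf : SemiSlant.IsIsometricImmersion E E' f)
    (DT Dθ : ∀ p : M, Submodule ℝ (TangentSpace 𝓘(ℝ, E) p)) (m₁ m₂ : ℕ) (θ : M → ℝ)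
    (hM : SemiSlant.IsProperPointwiseSemiSlant J f DT Dθ m₁ m₂ θ)
    -- the complex points of the slant distribution have empty interior
    (hθ : Dense {p : M | Real.sin (θ p) ≠ 0}) :
    (SemiSlant.IsIntegrable DT ↔
      ∀ X Y V : ∀ p : M, TangentSpace 𝓘(ℝ, E) p,
        SemiSlant.IsSection DT X → SemiSlant.IsSection DT Y → SemiSlant.IsSection Dθ V → ∀ p : M,
          inner ℝ (SemiSlant.secondForm nabla f X (SemiSlant.opT J f Y) p)
              (SemiSlant.opF J f V p)
            = inner ℝ (SemiSlant.secondForm nabla f (SemiSlant.opT J f X) Y p)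
              (SemiSlant.opF J f V p)) ∧
    (SemiSlant.IsIntegrable Dθ ↔
      ∀ V W X : ∀ p : M, TangentSpace 𝓘(ℝ, E) p,
        SemiSlant.IsSection Dθ V → SemiSlant.IsSection Dθ W → SemiSlant.IsSection DT X → ∀ p : M,
          inner ℝ
              (SemiSlant.shape nabla f (SemiSlant.opF J f (SemiSlant.opT J f W)) V p
                - SemiSlant.shape nabla f (SemiSlant.opF J f (SemiSlant.opT J f V)) W p)
              (X p)
            = inner ℝ
              (SemiSlant.shape nabla f (SemiSlant.opF J f W) V p
                - SemiSlant.shape nabla f (SemiSlant.opF J f V) W p)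
              (SemiSlant.opT J f X p)) := by
  have hM' := hM.toIsPointwiseSemiSlant
  have hsin : Dense {p : M | Real.sin (θ p) ^ 2 ≠ 0} := by
    simpa only [ne_eq, pow_eq_zero_iff, OfNat.ofNat_ne_zero, not_false_eq_true] using hθ
  constructor
  · rw [SemiSlant.isIntegrable_iff_of_dense hM'.distribution_θ hM'.isCompl hM'.orthogonal hsin]
    refine forall₃_congr fun X Y V ↦ forall₃_congr fun hX hY hV ↦ forall_congr' fun p ↦ ?_
    rw [hM'.sin_sq_mul_inner_mlieBracket_holomorphic hN hf hX hY (hV.2 p), sub_eq_zero]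
  -- The two distributions exchange roles: brackets of sections of Dθ are tested against DT.
  · rw [SemiSlant.isIntegrable_iff_of_dense hM'.distribution_T (fun p ↦ (hM'.isCompl p).symm)
      (fun p u hu v hv ↦ by rw [real_inner_comm, hM'.orthogonal p v hv u hu]) hsin]
    refine forall₃_congr fun V W X ↦ forall₃_congr fun hV hW hX ↦ forall_congr' fun p ↦ ?_
    rw [hM'.sin_sq_mul_inner_mlieBracket_slant hN hf hV hW hX, sub_eq_zero]
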